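/- Let $W$ be the dual space of a complex normed space, and let $X\subset Y\subset W$ be linear subspaces with the norm of $W$. A bounded linear functional on $X$ (or $Y$) is called absolutely continuous relative to $W$ if it extends to a weak-$*$ continuous linear functional on $W$. The inclusion $X\subset Y$ has the Gleason--Whitney property relative to $W$ if, whenever $\varphi$ is an absolutely continuous functional on $X$ and $\psi$ is a Hahn--Banach (i.e. norm-preserving linear) extension of $\varphi$ to $Y$, then $\psi$ is absolutely continuous on $Y$. Notation. $L^\infty(\mu)$ carries its weak-$*$ topology as the dual of $L^1(\mu)$, and $B(H)$ (the bounded operators on a Hilbert space $H$) its weak-$*$ topology as the dual of the trace class operators. $[0,1]$ carries Lebesgue measure, the circle $\mathbb T$ normalized arclength measure, $\mathbb T^d$ the product of these measures, and the unit sphere $\mathbb S_d\subset\mathbb C^d$ the rotation invariant probability measure. $\mathbb D$, $\mathbb B_d$ and $\mathbb D^d$ are the open unit disc, the open Euclidean unit ball of $\mathbb C^d$ and the open unit polydisc. For a domain $U$, $H^\infty(U)$ is the algebra of bounded holomorphic functions on $U$ with the supremum norm; $A(\mathbb D)$ is the algebra of functions continuous on $\overline{\mathbb D}$ and holomorphic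 on $\mathbb D$; $H^2$ is the Hardy space of holomorphic functions $\sum_n a_nz^n$ on $\mathbb D$ with $\sum_n|a_n|^2<\infty$. The algebras $H^\infty(\mathbb D)$, $H^\infty(\mathbb B_d)$ and $H^\infty(\mathbb D^d)$ are regarded as subspaces of $L^\infty(\mathbb T)$, $L^\infty(\mathbb S_d)$ and $L^\infty(\mathbb T^d)$ by taking radial boundary limits $\lim_{r\to1^-}f(r\zeta)$ almost everywhere; $L^\infty[0,1]$ and $H^\infty(\mathbb D)$ are regarded as subspaces of $B(L^2[0,1])$ and $B(H^2)$ by letting functions act as multiplication operators. Theorem. Each of the following inclusions fails to have the Gleason--Whitney property (relative to the second algebra, unless otherwise stated): (a) $C([0,1])\subset L^\infty([0,1])$; (b) $L^\infty([0,1])\subset B(L^2([0,1]))$; (c) $A(\mathbb D)\subset H^\infty(\mathbb D)$, relative to $L^\infty(\mathbb T)$; (d) $H^\infty(\mathbb D)\subset B(H^2)$; (e) $H^\infty(\mathbb D)\subset L^\infty(\overline{\mathbb D},A)$, where $A$ is area measure; (f) $H^\infty(\mathbb B_d)\subset L^\infty(\mathbb S_d)$ for every integer $d\ge2$; (g) $H^\infty(\mathbb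 D^d)\subset L^\infty(\mathbb T^d)$ for every integer $d\ge2$. -/

import Mathlib

open MeasureTheory Filter Topology
open scoped ENNReal

namespace GleasonWhitney

/-! ### Absolutely continuous functionals and the Gleason–Whitney property -/

section General

variable {W P : Type*} [NormedAddCommGroup W] [NormedSpace ℂ W]

/-- The weak-* topology of a dual space `W`, as given by a pairing `p` of `W` with (a total subset
of) its predual: the coarsest topology making `w ↦ p w q` continuous for every `q`. -/
noncomputable abbrev weakStarTopology (p : W → P → ℂ) : TopologicalSpace W :=
  TopologicalSpace.induced p inferInstance

/-- A bounded linear functional on a subspace `X` of a dual space `W` is absolutely continuous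
relative to `W` if it extends to a weak-* continuous linear functional on all of `W`. Here `p` is
the pairing of `W` with its predual; boundedness on `X` refers to the norm. -/
def AbsCont (p : W → P → ℂ) (X : Submodule ℂ W) (φ : X →L[ℂ] ℂ) : Prop :=
  ∃ Φ : W →ₗ[ℂ] ℂ, Continuous[weakStarTopology p, inferInstance] Φ ∧ ∀ x : X, Φ (x : W) = φ x

/-- `ψ` is a Hahn–Banach (that is, norm preserving) extension of `φ`. -/
def IsHahnBanachExtension {X Y : Submodule ℂ W} (h : X ≤ Y) (φ : X →L[ℂ] ℂ) (ψ : Y →L[ℂ] ℂ) :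
    Prop :=
  (∀ x : X, ψ (Submodule.inclusion h x) = φ x) ∧ ‖ψ‖ = ‖φ‖

/-- The inclusion `X ⊆ Y` of subspaces of the dual space `W` (with predual pairing `p`) has the
Gleason–Whitney property relative to `W`: every Hahn–Banach extension to `Y` of an absolutely
continuous functional on `X` is absolutely continuous. -/
def HasGleasonWhitney (p : W → P → ℂ) (X Y : Submodule ℂ W) (h : X ≤ Y) : Prop :=
  ∀ φ : X →L[ℂ] ℂ, AbsCont p X φ →
    ∀ ψ : Y →L[ℂ] ℂ, IsHahnBanachExtension h φ ψ → AbsCont p Y ψ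

end General

/-! ### The predual pairings of `L^∞(μ)` and of `B(H)` -/

/-- The pairing `(f, g) ↦ ∫ f g dμ` of `L^∞(μ)` with its predual `L^1(μ)`. -/
noncomputable def linftyPairing {α : Type*} [MeasurableSpace α] (μ : Measure α)
    (f : Lp ℂ ∞ μ) (g : Lp ℂ 1 μ) : ℂ :=
  ∫ x, f x * g x ∂μ

/-- The pairing of `B(H)` with its predual, the trace class: a trace class operator is given by two
square summable sequences `(xₙ)` and `(yₙ)` in `H` as `∑ₙ ⟨·, yₙ⟩ xₙ`, and it is paired with `T` by
`∑ₙ ⟨T xₙ, yₙ⟩`. The topology of this pairing is the weak-* (ultraweak, `σ`-weak) topology. -/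
noncomputable def bhPairing (H : Type*) [NormedAddCommGroup H] [InnerProductSpace ℂ H]
    (T : H →L[ℂ] H) (q : lp (fun _ : ℕ => H) 2 × lp (fun _ : ℕ => H) 2) : ℂ :=
  ∑' n, inner ℂ (q.2 n) (T (q.1 n))

/-! ### Function algebras -/

/-- `f` is a bounded holomorphic function on the open set `U`. -/
def IsHinf {E : Type*} [NormedAddCommGroup E] [NormedSpace ℂ E] (U : Set E) (f : E → ℂ) : Prop :=
  DifferentiableOn ℂ f U ∧ ∃ C : ℝ, ∀ z ∈ U, ‖f z‖ ≤ C

section IsHinf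

variable {E : Type*} [NormedAddCommGroup E] [NormedSpace ℂ E] {U : Set E} {f g : E → ℂ}

theorem IsHinf.zero : IsHinf U (0 : E → ℂ) :=
  ⟨differentiableOn_const 0, 0, by simp⟩

theorem IsHinf.add (hf : IsHinf U f) (hg : IsHinf U g) : IsHinf U (f + g) := by
  obtain ⟨hf, C, hC⟩ := hf
  obtain ⟨hg, D, hD⟩ := hg
  exact ⟨hf.add hg, C + D, fun z hz =>
    (norm_add_le _ _).trans (add_le_add (hC z hz) (hD z hz))⟩

theorem IsHinf.smul (c : ℂ) (hf : IsHinf U f) : IsHinf U (c • f) := by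
  obtain ⟨hf, C, hC⟩ := hf
  refine ⟨hf.const_smul c, ‖c‖ * C, fun z hz => ?_⟩
  rw [Pi.smul_apply, norm_smul]
  exact mul_le_mul_of_nonneg_left (hC z hz) (norm_nonneg c)

end IsHinf

/-- `C[0,1]` as a subspace of `L^∞[0,1]` (Lebesgue measure). -/
noncomputable def continuousSubspace : Submodule ℂ (Lp ℂ ∞ (volume : Measure unitInterval)) :=
  LinearMap.range
    (ContinuousMap.toLp ∞ (volume : Measure unitInterval) ℂ :
      C(unitInterval, ℂ) →L[ℂ] Lp ℂ ∞ (volume : Measure unitInterval)).toLinearMap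

/-- The Hilbert space `L²[0,1]` (Lebesgue measure). -/
abbrev L2I : Type := Lp ℂ 2 (volume : Measure unitInterval)

/-- `L^∞[0,1]` as a subspace of `B(L²[0,1])`: the multiplication operators `g ↦ f g`. -/
def multiplicationOperators : Submodule ℂ (L2I →L[ℂ] L2I) where
  carrier := {T | ∃ f : Lp ℂ ∞ (volume : Measure unitInterval),
    ∀ g : L2I, T g =ᵐ[volume] fun t => f t * g t}
  zero_mem' := by
    refine ⟨0, fun g => ?_⟩
    filter_upwards [Lp.coeFn_zero ℂ 2 (volume : Measure unitInterval),
      Lp.coeFn_zero ℂ ∞ (volume : Measure unitInterval)] with t h1 h2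
    rw [zero_apply, h1, h2, Pi.zero_apply]
    exact (zero_mul _).symm
  add_mem' := by
    rintro S T ⟨f, hf⟩ ⟨g, hg⟩
    refine ⟨f + g, fun u => ?_⟩
    filter_upwards [hf u, hg u, Lp.coeFn_add f g, Lp.coeFn_add (S u) (T u)] with t h1 h2 h3 h4
    rw [add_apply]
    rw [h4, h3, Pi.add_apply, Pi.add_apply, h1, h2, add_mul]
  smul_mem' := by
    rintro c T ⟨f, hf⟩
    refine ⟨c • f, fun u => ?_⟩
    filter_upwards [hf u, Lp.coeFn_smul c f, Lp.coeFn_smul c (T u)] with t h1 h2 h3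
    rw [smul_apply]
    rw [h3, h2, Pi.smul_apply, Pi.smul_apply, h1, smul_eq_mul, smul_eq_mul, mul_assoc]

/-! #### The unit circle and the torus -/

noncomputable instance : MeasurableSpace Circle := borel Circle

instance : BorelSpace Circle := ⟨rfl⟩

/-- Normalized arclength measure on the unit circle. -/
noncomputable def circleMeasure : Measure Circle :=
  ENNReal.ofReal (2 * Real.pi)⁻¹ •
    (volume.restrict (Set.Ioc 0 (2 * Real.pi))).map (fun t : ℝ => Circle.exp t)

/-- The product measure on the torus `𝕋^d`. -/
noncomputable def torusMeasure (d : ℕ) : Measure (Fin d → Circle) :=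
  Measure.pi fun _ => circleMeasure

/-- The disc algebra `A(𝔻)` inside `L^∞(𝕋)`: boundary values of the functions which are continuous
on the closed disc and holomorphic on the open disc. -/
noncomputable def discAlgebra : Submodule ℂ (Lp ℂ ∞ circleMeasure) where
  carrier := {F | ∃ f : ℂ → ℂ, DiffContOnCl ℂ f (Metric.ball 0 1) ∧
    ∀ᵐ ζ ∂circleMeasure, F ζ = f (ζ : ℂ)}
  zero_mem' := by
    refine ⟨0, diffContOnCl_const, ?_⟩
    filter_upwards [Lp.coeFn_zero ℂ ∞ circleMeasure] with t h
    rw [h, Pi.zero_apply, Pi.zero_apply]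
  add_mem' := by
    rintro F G ⟨f, hf, hF⟩ ⟨g, hg, hG⟩
    refine ⟨f + g, hf.add hg, ?_⟩
    filter_upwards [hF, hG, Lp.coeFn_add F G] with t h1 h2 h3
    rw [h3, Pi.add_apply, Pi.add_apply, h1, h2]
  smul_mem' := by
    rintro c F ⟨f, hf, hF⟩
    refine ⟨c • f, hf.const_smul c, ?_⟩
    filter_upwards [hF, Lp.coeFn_smul c F] with t h1 h2
    rw [h2, Pi.smul_apply, Pi.smul_apply, h1]

/-- For a measure `μ` on a space `S` mapped into `E` by `ι`, the space of those elements of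
`L^∞(μ)` which are `μ`-almost everywhere the radial limit `lim_{r → 1-} f (r ζ)` of a bounded
holomorphic function `f` on `U`. -/
def radialBoundaryValues {E S : Type*} [NormedAddCommGroup E] [NormedSpace ℂ E]
    [MeasurableSpace S] (μ : Measure S) (ι : S → E) (U : Set E) : Submodule ℂ (Lp ℂ ∞ μ) where
  carrier := {F | ∃ f : E → ℂ, IsHinf U f ∧
    ∀ᵐ ζ ∂μ, Tendsto (fun r : ℝ => f ((r : ℂ) • ι ζ)) (𝓝[<] 1) (𝓝 (F ζ))}
  zero_mem' := by
    refine ⟨0, IsHinf.zero, ?_⟩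
    filter_upwards [Lp.coeFn_zero ℂ ∞ μ] with t h
    rw [h]
    exact tendsto_const_nhds
  add_mem' := by
    rintro F G ⟨f, hf, hF⟩ ⟨g, hg, hG⟩
    refine ⟨f + g, hf.add hg, ?_⟩
    filter_upwards [hF, hG, Lp.coeFn_add F G] with t h1 h2 h3
    rw [h3]
    exact h1.add h2
  smul_mem' := by
    rintro c F ⟨f, hf, hF⟩
    refine ⟨c • f, hf.smul c, ?_⟩
    filter_upwards [hF, Lp.coeFn_smul c F] with t h1 h2
    rw [h2]
    exact h1.const_smul c

/-- `H^∞(𝔻)` as a subspace of `L^∞(𝕋)`, through radial boundary values. -/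
noncomputable def hinfCircle : Submodule ℂ (Lp ℂ ∞ circleMeasure) :=
  radialBoundaryValues circleMeasure (fun ζ : Circle => (ζ : ℂ)) (Metric.ball 0 1)

theorem discAlgebra_le_hinfCircle : discAlgebra ≤ hinfCircle := by
  rintro F ⟨f, hf, hF⟩
  have hcont : ContinuousOn f (Metric.closedBall 0 1) := by
    have := hf.continuousOn
    rwa [closure_ball (0 : ℂ) one_ne_zero] at this
  obtain ⟨C, hC⟩ := (isCompact_closedBall (0 : ℂ) 1).exists_bound_of_continuousOn hcont
  refine ⟨f, ⟨hf.differentiableOn, C, fun z hz => hC z (Metric.ball_subset_closedBall hz)⟩, ?_⟩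
  filter_upwards [hF] with ζ hζ
  rw [hζ]
  have h1 : Tendsto f (𝓝[Metric.closedBall 0 1] (ζ : ℂ)) (𝓝 (f ζ)) := hcont (ζ : ℂ) (by simp [Circle.norm_coe])
  refine h1.comp (tendsto_nhdsWithin_iff.2 ⟨?_, ?_⟩)
  · have : Continuous fun r : ℝ => (r : ℂ) • (ζ : ℂ) := by fun_prop
    have h2 := this.tendsto 1
    simp only [Complex.ofReal_one, one_smul] at h2
    exact h2.mono_left nhdsWithin_le_nhds
  · filter_upwards [Ioo_mem_nhdsLT (show (0 : ℝ) < 1 from one_pos)] with r hr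
    simp [abs_of_pos hr.1, hr.2.le, Circle.norm_coe]

/-- `H^∞(𝔻^d)` as a subspace of `L^∞(𝕋^d)`, through radial boundary values. -/
noncomputable def hinfPolydisc (d : ℕ) : Submodule ℂ (Lp ℂ ∞ (torusMeasure d)) :=
  radialBoundaryValues (torusMeasure d) (fun (ζ : Fin d → Circle) (i : Fin d) => (ζ i : ℂ))
    {z : Fin d → ℂ | ∀ i, ‖z i‖ < 1}

/-! #### The unit sphere of `ℂ^d` -/

/-- The unit sphere of `ℂ^d`. -/
abbrev Sph (d : ℕ) : Type := Metric.sphere (0 : EuclideanSpace ℂ (Fin d)) 1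

/-- Normalized surface measure on the unit sphere of `ℂ^d`. -/
noncomputable def sphereMeasure (d : ℕ) : Measure (Sph d) :=
  ((volume : Measure (EuclideanSpace ℂ (Fin d))).toSphere Set.univ)⁻¹ •
    (volume : Measure (EuclideanSpace ℂ (Fin d))).toSphere

/-- `H^∞(𝔹_d)` as a subspace of `L^∞(𝕊_d)`, through radial boundary values. -/
noncomputable def hinfBall (d : ℕ) : Submodule ℂ (Lp ℂ ∞ (sphereMeasure d)) :=
  radialBoundaryValues (sphereMeasure d) (fun ζ : Sph d => (ζ : EuclideanSpace ℂ (Fin d)))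
    (Metric.ball 0 1)

/-! #### The closed disc with area measure -/

/-- Area measure on the closed unit disc. -/
noncomputable def areaMeasure : Measure (Metric.closedBall (0 : ℂ) 1) :=
  (volume : Measure ℂ).comap Subtype.val

/-- `H^∞(𝔻)` as a subspace of `L^∞` of the closed disc with area measure (the boundary circle is a
null set). -/
noncomputable def hinfArea : Submodule ℂ (Lp ℂ ∞ areaMeasure) where
  carrier := {F | ∃ f : ℂ → ℂ, IsHinf (Metric.ball 0 1) f ∧
    ∀ᵐ z : Metric.closedBall (0 : ℂ) 1 ∂areaMeasure, (z : ℂ) ∈ Metric.ball (0 : ℂ) 1 → F z = f (z : ℂ)}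
  zero_mem' := by
    refine ⟨0, IsHinf.zero, ?_⟩
    filter_upwards [Lp.coeFn_zero ℂ ∞ areaMeasure] with t h _
    rw [h, Pi.zero_apply, Pi.zero_apply]
  add_mem' := by
    rintro F G ⟨f, hf, hF⟩ ⟨g, hg, hG⟩
    refine ⟨f + g, hf.add hg, ?_⟩
    filter_upwards [hF, hG, Lp.coeFn_add F G] with t h1 h2 h3 ht
    rw [h3, Pi.add_apply, Pi.add_apply, h1 ht, h2 ht]
  smul_mem' := by
    rintro c F ⟨f, hf, hF⟩
    refine ⟨c • f, hf.smul c, ?_⟩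
    filter_upwards [hF, Lp.coeFn_smul c F] with t h1 h2 ht
    rw [h2, Pi.smul_apply, Pi.smul_apply, h1 ht]

/-! #### The Hardy space `H²(𝔻)` -/

/-- The Hardy space `H²(𝔻)` of the holomorphic functions `z ↦ ∑ₙ aₙ zⁿ` on the disc with square
summable Taylor coefficients, with the inner product of the coefficient sequences. -/
abbrev HardySpace : Type := lp (fun _ : ℕ => ℂ) 2

/-- The holomorphic function on the disc with Taylor coefficients `a`. -/
noncomputable def HardySpace.toFun (a : HardySpace) (z : ℂ) : ℂ := ∑' n : ℕ, a n * z ^ n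

theorem HardySpace.summable (a : HardySpace) {z : ℂ} (hz : z ∈ Metric.ball (0 : ℂ) 1) :
    Summable fun n : ℕ => a n * z ^ n := by
  have hz' : ‖z‖ < 1 := by simpa using hz
  refine Summable.of_norm_bounded (g := fun n : ℕ => ‖a‖ * ‖z‖ ^ n)
    ((summable_geometric_of_lt_one (norm_nonneg z) hz').mul_left _) fun n => ?_
  rw [norm_mul, norm_pow]
  exact mul_le_mul_of_nonneg_right (lp.norm_apply_le_norm two_ne_zero a n) (by positivity)

/-- `H^∞(𝔻)` as a subspace of `B(H²(𝔻))`: the multiplication operators `u ↦ f u` with a bounded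
holomorphic function `f`. -/
noncomputable def hinfHardy : Submodule ℂ (HardySpace →L[ℂ] HardySpace) where
  carrier := {T | ∃ f : ℂ → ℂ, IsHinf (Metric.ball 0 1) f ∧
    ∀ u : HardySpace, ∀ z ∈ Metric.ball (0 : ℂ) 1,
      HardySpace.toFun (T u) z = f z * HardySpace.toFun u z}
  zero_mem' := ⟨0, IsHinf.zero, fun u z _ => by simp [HardySpace.toFun]⟩
  add_mem' := by
    rintro S T ⟨f, hf, hS⟩ ⟨g, hg, hT⟩
    refine ⟨f + g, hf.add hg, fun u z hz => ?_⟩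
    rw [Pi.add_apply, add_mul, ← hS u z hz, ← hT u z hz]
    simp only [HardySpace.toFun]
    rw [← (HardySpace.summable (S u) hz).tsum_add (HardySpace.summable (T u) hz)]
    simp [add_mul]
  smul_mem' := by
    rintro c T ⟨f, hf, hT⟩
    refine ⟨c • f, hf.smul c, fun u z hz => ?_⟩
    rw [Pi.smul_apply, smul_eq_mul, mul_assoc, ← hT u z hz]
    simp only [HardySpace.toFun]
    rw [← tsum_mul_left]
    simp [mul_assoc]

end GleasonWhitney

/-!
In each of the inclusions `X ⊆ Y`, the functional to be extended is a mean: it is integration over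
the whole space or over a subset, or a vector state `T ↦ ⟨T u, u⟩`. It is absolutely continuous and
attains its norm at the unit of `X`, so that every functional of norm at most one which agrees with
it on `X` is a Hahn–Banach extension. Singular extensions are obtained in two ways.

*Limits of functionals* (`not_hasGleasonWhitney_of_sequence`). If all functionals of a sequence
`ψ n` on `W` have norm at most one and agree on `X`, then so does a weak-* cluster point, and it is
not absolutely continuous if it fails to respect the limit of some weak-* convergent sequence.
* For multiplication operators, `ψ n` is the vector state of the `n`-th member of an orthonormal
  sequence: `exp (2 π i n t)` in `L²[0,1]`, where `ψ n` gives the integral of the symbol, and `zⁿ` in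
  `H²`, where `ψ n` gives the value of the symbol at `0`. A cluster point annihilates the projections
  onto the spans of finitely many members, but not their strong limit
  (`not_hasGleasonWhitney_of_orthonormal`).
* For bounded holomorphic functions in several variables, or on the disc with area measure, `ψ n` is
  the average over a rotation invariant set `A n`. By Fubini's theorem and the mean value property
  on the discs `{w • v | ‖w‖ < 1}`, this is evaluation at `0` on `X`. There are infinitely many
  disjoint such sets of positive measure, given by the values of `|ζ₀|` on the sphere, of
  `Re (ζ₀ / ζ₁)` on the torus and of `|z|` on the disc. A cluster point takes the value `1` at the
  indicators of `⋃ n ≥ m, A n`, which decrease to zero (`not_hasGleasonWhitney_of_averages`).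

*One-dimensional extensions* (`not_hasGleasonWhitney_of_dense`). If `X` consists of continuous
functions and `F ∈ Y` essentially tends to zero at a dense set of points, then
`sup |f| ≤ ‖f + F‖` for `f ∈ X`, so that the mean `Φ` on `X` has a Hahn–Banach extension which
vanishes at `F`. If `F` is a weak-* limit of elements of `X`, an absolutely continuous extension
takes the value `Φ F` at `F`; so it is enough that `Φ F ≠ 0`.
* For `C[0,1]`, `F` is the indicator of a closed nowhere dense set of positive measure.
* For the disc algebra, `F` is the boundary function of `exp (-g)`, where
  `g z = ∑ c k log (2 / (1 - z / ζ k))` with a dense sequence `ζ k` in the circle and weights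
  `c k > 0` which are so small that the radial limits of `g` exist almost everywhere by the
  Borel–Cantelli lemma and dominated convergence (`exists_weights`). The mean of `F` is the value of
  `exp (-g)` at `0`.
-/

namespace GleasonWhitney

/-! ### Two criteria for the failure of the Gleason–Whitney property -/

section Criteria

variable {W P : Type*} [NormedAddCommGroup W] [NormedSpace ℂ W] {p : W → P → ℂ}

theorem AbsCont.tendsto {Y : Submodule ℂ W} {ψ : Y →L[ℂ] ℂ} (hψ : AbsCont p Y ψ)
    {u : ℕ → Y} {y : Y} (hu : ∀ q, Tendsto (fun n => p (u n) q) atTop (𝓝 (p y q))) :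
    Tendsto (fun n => ψ (u n)) atTop (𝓝 (ψ y)) := by
  obtain ⟨Φ, hΦ, hΦψ⟩ := hψ
  let _ : TopologicalSpace W := weakStarTopology p
  have h1 : Tendsto (fun n => (u n : W)) atTop (𝓝 (y : W)) := by
    rw [nhds_induced, tendsto_comap_iff, tendsto_pi_nhds]
    exact hu
  have h2 := (hΦ.tendsto (y : W)).comp h1
  rw [hΦψ] at h2
  refine h2.congr fun n => ?_
  simp [hΦψ]

theorem absCont_domRestrict {Φ : W →L[ℂ] ℂ} {q : P} (hΦ : ∀ w, Φ w = p w q)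
    (X : Submodule ℂ W) : AbsCont p X (Φ.domRestrict X) := by
  refine ⟨Φ.toLinearMap, ?_, fun x => rfl⟩
  have : (Φ.toLinearMap : W → ℂ) = fun w => p w q := funext hΦ
  rw [this]
  exact @Continuous.comp W (P → ℂ) ℂ (weakStarTopology p) _ _ p (fun f => f q)
    (continuous_apply q) continuous_induced_dom

theorem norm_domRestrict_eq_one {Φ : W →L[ℂ] ℂ} (hΦ : ‖Φ‖ ≤ 1) {X : Submodule ℂ W} {e : W}
    (he : e ∈ X) (he1 : ‖e‖ ≤ 1) (hΦe : Φ e = 1) : ‖Φ.domRestrict X‖ = 1 := by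
  apply le_antisymm
  · refine ContinuousLinearMap.opNorm_le_bound _ zero_le_one fun x => ?_
    exact Φ.le_of_opNorm_le hΦ x
  · have h := (Φ.domRestrict X).le_opNorm_of_le (x := ⟨e, he⟩) he1
    rw [mul_one] at h
    refine le_trans ?_ h
    simp [hΦe]

/-- Two functionals of norm one on `W` which coincide on `X`, where they are absolutely continuous
and attain their norm, restrict to a functional and a Hahn–Banach extension of it. If the
extension is not sequentially weak-* continuous, the Gleason–Whitney property fails. -/
theorem not_hasGleasonWhitney_of_extension {X Y : Submodule ℂ W} (h : X ≤ Y)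
    {Φ Ψ : W →L[ℂ] ℂ} {q : P} (hΦ : ∀ w, Φ w = p w q) (hΦ1 : ‖Φ‖ ≤ 1) (hΨ1 : ‖Ψ‖ ≤ 1)
    (hX : ∀ x ∈ X, Ψ x = Φ x) {e : W} (he : e ∈ X) (he1 : ‖e‖ ≤ 1) (hΦe : Φ e = 1)
    {u : ℕ → W} {y : W} (huY : ∀ n, u n ∈ Y) (hyY : y ∈ Y)
    (hu : ∀ q, Tendsto (fun n => p (u n) q) atTop (𝓝 (p y q))) {a : ℂ}
    (ha : Tendsto (fun n => Ψ (u n)) atTop (𝓝 a)) (hne : a ≠ Ψ y) :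
    ¬ HasGleasonWhitney p X Y h := by
  intro H
  have hψ := H (Φ.domRestrict X) (absCont_domRestrict hΦ X) (Ψ.domRestrict Y)
    ⟨fun x => hX x x.2, by
      rw [norm_domRestrict_eq_one hΦ1 he he1 hΦe,
        norm_domRestrict_eq_one hΨ1 (h he) he1 ((hX e he).trans hΦe)]⟩
  have ht := hψ.tendsto (u := fun n => ⟨u n, huY n⟩) (y := ⟨y, hyY⟩) hu
  exact hne (tendsto_nhds_unique ha ht)

/-- A cluster point `Ψ` of a sequence of functionals `ψ n` which all extend the same absolutely
continuous functional of norm one is not absolutely continuous if the iterated limits of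
`ψ n (u m)`, for a weak-* convergent sequence `u`, are different. -/
theorem not_hasGleasonWhitney_of_sequence {X : Submodule ℂ W} {ψ : ℕ → W →L[ℂ] ℂ} {q : P}
    (hψ0 : ∀ w, ψ 0 w = p w q) (hψ1 : ∀ n, ‖ψ n‖ ≤ 1) (hX : ∀ x ∈ X, ∀ n, ψ n x = ψ 0 x)
    {e : W} (he : e ∈ X) (he1 : ‖e‖ ≤ 1) (hψe : ψ 0 e = 1) {u : ℕ → W} {y : W}
    (hu : ∀ q, Tendsto (fun n => p (u n) q) atTop (𝓝 (p y q))) {a b : ℂ}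
    (ha : ∀ m, ∀ n ≥ m, ψ n (u m) = a) (hb : ∀ n, ψ n y = b) (hab : a ≠ b) :
    ¬ HasGleasonWhitney p X ⊤ le_top := by
  -- the cluster point exists by the Banach–Alaoglu theorem
  obtain ⟨Ψ, hΨ1, hΨ⟩ := isCompact_iff_ultrafilter_le_nhds.1
    (WeakDual.isCompact_closedBall (0 : StrongDual ℂ W) 1)
    ((hyperfilter ℕ : Ultrafilter ℕ).map fun n => StrongDual.toWeakDual (ψ n)) (by
      rw [le_principal_iff]
      refine Ultrafilter.mem_map.2 (Eventually.of_forall fun n => ?_)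
      simpa using hψ1 n)
  have key : ∀ w, Tendsto (fun n => ψ n w) (hyperfilter ℕ) (𝓝 (WeakDual.toStrongDual Ψ w)) :=
    fun w => ((WeakDual.eval_continuous w).tendsto Ψ).comp hΨ
  have const : ∀ w c, (∀ᶠ n in atTop, ψ n w = c) → WeakDual.toStrongDual Ψ w = c := by
    intro w c hc
    refine tendsto_nhds_unique (key w) (tendsto_const_nhds.congr' ?_)
    exact Nat.hyperfilter_le_atTop (hc.mono fun n hn => hn.symm)
  refine not_hasGleasonWhitney_of_extension le_top (Φ := ψ 0) (Ψ := WeakDual.toStrongDual Ψ)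
    hψ0 (hψ1 0) (by simpa using hΨ1) (fun x hx => const x _ (Eventually.of_forall (hX x hx)))
    he he1 hψe (fun _ => trivial) trivial hu
    (tendsto_const_nhds.congr fun m => (const _ a (eventually_atTop.2 ⟨m, ha m⟩)).symm) ?_
  rwa [const y b (Eventually.of_forall hb)]

/-- The inequality `‖Φ x‖ ≤ ‖x + y‖` says that the functional `x + t y ↦ Φ x` on the span of `X`
and `y` has norm at most one, so that it has a Hahn–Banach extension. If `y` is a weak-* limit of
points of `X` and `Φ y ≠ 0`, this extension is not absolutely continuous. -/
theorem not_hasGleasonWhitney_of_norm_le {X Y : Submodule ℂ W} (h : X ≤ Y)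
    {Φ : W →L[ℂ] ℂ} {q : P} (hΦ : ∀ w, Φ w = p w q) (hΦ1 : ‖Φ‖ ≤ 1) {e : W} (he : e ∈ X)
    (he1 : ‖e‖ ≤ 1) (hΦe : Φ e = 1) {u : ℕ → W} {y : W} (huX : ∀ n, u n ∈ X) (hyY : y ∈ Y)
    (hu : ∀ q, Tendsto (fun n => p (u n) q) atTop (𝓝 (p y q))) (hΦy : Φ y ≠ 0)
    (hX : ∀ x ∈ X, ‖Φ x‖ ≤ ‖x + y‖) : ¬ HasGleasonWhitney p X Y h := by
  have hyX : y ∉ X := by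
    intro hy
    have h1 := hX (-y) (X.neg_mem hy)
    rw [neg_add_cancel, norm_zero, map_neg, norm_neg, norm_le_zero_iff] at h1
    exact hΦy h1
  let f : W →ₗ.[ℂ] ℂ := LinearPMap.supSpanSingleton ⟨X, Φ.toLinearMap.domRestrict X⟩ y 0 hyX
  have hf : ∀ x (_ : x ∈ X) (t : ℂ) (hm : x + t • y ∈ f.domain), f ⟨x + t • y, hm⟩ = Φ x :=
    fun x hx t _ => (LinearPMap.supSpanSingleton_apply_mk ⟨X, Φ.toLinearMap.domRestrict X⟩ y 0 hyX
      x hx t).trans (by simp)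
  have hmem : ∀ x ∈ X, ∀ t : ℂ, x + t • y ∈ f.domain := fun x hx t =>
    Submodule.add_mem_sup hx (Submodule.smul_mem _ _ (Submodule.mem_span_singleton_self y))
  have hbound : ∀ z : f.domain, ‖f z‖ ≤ 1 * ‖z‖ := by
    rintro ⟨z, hz⟩
    obtain ⟨x, hx, z', hz', rfl⟩ := Submodule.mem_sup.1 hz
    obtain ⟨t, rfl⟩ := Submodule.mem_span_singleton.1 hz'
    rw [hf x hx, one_mul]
    change _ ≤ ‖x + t • y‖
    rcases eq_or_ne t 0 with rfl | ht
    · simpa using Φ.le_of_opNorm_le hΦ1 x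
    · have h1 := hX (t⁻¹ • x) (X.smul_mem _ hx)
      have h2 : Φ x = t • Φ (t⁻¹ • x) := by rw [map_smul, smul_inv_smul₀ ht]
      have h3 : x + t • y = t • (t⁻¹ • x + y) := by rw [smul_add, smul_inv_smul₀ ht]
      rw [h2, h3, norm_smul, norm_smul]
      gcongr
  obtain ⟨Ψ, hΨ, hΨn⟩ := exists_extension_norm_eq f.domain (f.toFun.mkContinuous 1 hbound)
  have hΨf : ∀ x (_ : x ∈ X) (t : ℂ), Ψ (x + t • y) = Φ x := fun x hx t =>
    (hΨ ⟨x + t • y, hmem x hx t⟩).trans (hf x hx t _)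
  have hΨX : ∀ x ∈ X, Ψ x = Φ x := fun x hx => by simpa using hΨf x hx 0
  have hlim : Tendsto (fun n => Ψ (u n)) atTop (𝓝 (Φ y)) := by
    simpa only [hΨX _ (huX _), hΦ] using hu q
  refine not_hasGleasonWhitney_of_extension h hΦ hΦ1
    (hΨn.trans_le (LinearMap.mkContinuous_norm_le _ zero_le_one _)) hΨX he he1 hΦe
    (fun n => h (huX n)) hyY hu hlim ?_
  have : Ψ y = 0 := by simpa using hΨf 0 X.zero_mem 1
  rwa [this]

end Criteria

/-! ### Vector states along an orthonormal sequence -/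

section Operators

variable {H : Type*} [NormedAddCommGroup H] [InnerProductSpace ℂ H]

/-- The functional `T ↦ ⟨T x, x⟩` on `B(H)`. -/
noncomputable def vectorFunctional (x : H) : (H →L[ℂ] H) →L[ℂ] ℂ :=
  (innerSL ℂ x).comp (ContinuousLinearMap.apply ℂ H x)

@[simp]
theorem vectorFunctional_apply (x : H) (T : H →L[ℂ] H) :
    vectorFunctional x T = inner ℂ x (T x) := rfl

theorem norm_vectorFunctional_le {x : H} (hx : ‖x‖ = 1) : ‖vectorFunctional x‖ ≤ 1 := by
  refine ContinuousLinearMap.opNorm_le_bound _ zero_le_one fun T => ?_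
  calc ‖inner ℂ x (T x)‖ ≤ ‖x‖ * ‖T x‖ := norm_inner_le_norm _ _
    _ ≤ ‖x‖ * (‖T‖ * ‖x‖) := by gcongr; exact T.le_opNorm x
    _ = 1 * ‖T‖ := by rw [hx]; ring

theorem vectorFunctional_eq_bhPairing (x : H) (T : H →L[ℂ] H) :
    vectorFunctional x T = bhPairing H T
      (lp.single 2 (0 : ℕ) x, lp.single 2 (0 : ℕ) x) := by
  rw [bhPairing, tsum_eq_single 0]
  · simp
  · intro n hn
    simp [lp.single_apply, Pi.single_eq_of_ne hn]

/-- A bounded, strongly convergent sequence of operators converges in the weak-* topology. -/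
theorem tendsto_bhPairing {T : ℕ → H →L[ℂ] H} {S : H →L[ℂ] H} (hT : ∀ m, ‖T m‖ ≤ 1)
    (hTS : ∀ x, Tendsto (fun m => T m x) atTop (𝓝 (S x)))
    (q : lp (fun _ : ℕ => H) 2 × lp (fun _ : ℕ => H) 2) :
    Tendsto (fun m => bhPairing H (T m) q) atTop (𝓝 (bhPairing H S q)) := by
  have hsum : Summable fun n => ‖q.2 n‖ * ‖q.1 n‖ :=
    lp.summable_mul (by rw [Real.holderConjugate_iff]; norm_num) q.2 q.1
  refine tendsto_tsum_of_dominated_convergence hsum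
    (fun n => Tendsto.inner tendsto_const_nhds (hTS _)) (Eventually.of_forall fun m n => ?_)
  refine (norm_inner_le_norm _ _).trans ?_
  gcongr
  simpa using (T m).le_of_opNorm_le (hT m) (q.1 n)

/-- A limit of the vector states along an orthonormal sequence annihilates the projections onto the
spans of its finite parts, but not their strong limit; so it is not absolutely continuous. -/
theorem not_hasGleasonWhitney_of_orthonormal [CompleteSpace H] {X : Submodule ℂ (H →L[ℂ] H)}
    {u : ℕ → H} (hu : Orthonormal ℂ u) (h1 : ContinuousLinearMap.id ℂ H ∈ X)
    (hX : ∀ T ∈ X, ∀ n, inner ℂ (u n) (T (u n)) = (inner ℂ (u 0) (T (u 0)) : ℂ)) :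
    ¬ HasGleasonWhitney (bhPairing H) X ⊤ le_top := by
  let U : ℕ → Submodule ℂ H := fun m => Submodule.span ℂ (u '' Set.Iio m)
  have hfin : ∀ m, FiniteDimensional ℂ (U m) := fun m =>
    FiniteDimensional.span_of_finite ℂ ((Set.finite_Iio m).image u)
  have hU : Monotone U := fun m n hmn =>
    Submodule.span_mono (Set.image_mono (Set.Iio_subset_Iio hmn))
  have hself : ∀ n, (inner ℂ (u n) (u n) : ℂ) = 1 := fun n => by
    rw [inner_self_eq_norm_sq_to_K, hu.1 n]; simp
  refine not_hasGleasonWhitney_of_sequence (ψ := fun n => vectorFunctional (u n))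
    (vectorFunctional_eq_bhPairing (u 0)) (fun n => norm_vectorFunctional_le (hu.1 n)) hX h1
    ContinuousLinearMap.norm_id_le (hself 0) (u := fun m => (U m).starProjection)
    (y := (⨆ m, U m).topologicalClosure.starProjection) (a := 0) (b := 1)
    (tendsto_bhPairing (fun m => Submodule.starProjection_norm_le _)
      (Submodule.starProjection_tendsto_closure_iSup U hU)) ?_ ?_ zero_ne_one
  · intro m n hmn
    have : u n ∈ (U m)ᗮ := by
      rw [Submodule.mem_orthogonal]
      intro v hv
      induction hv using Submodule.span_induction with
      | mem x hx =>
        obtain ⟨k, hk, rfl⟩ := hx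
        exact hu.2 (ne_of_lt (lt_of_lt_of_le hk hmn))
      | zero => simp
      | add x y _ _ hx hy => rw [inner_add_left, hx, hy, add_zero]
      | smul a x _ hx => rw [inner_smul_left, hx, mul_zero]
    rw [vectorFunctional_apply, (Submodule.starProjection_apply_eq_zero_iff _).2 this,
      inner_zero_right]
  · intro n
    have : u n ∈ (⨆ m, U m).topologicalClosure :=
      Submodule.le_topologicalClosure _ (le_iSup U (n + 1)
        (Submodule.subset_span ⟨n, Nat.lt_succ_self n, rfl⟩))
    rw [vectorFunctional_apply, Submodule.starProjection_eq_self_iff.2 this, hself]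

end Operators

/-! ### Multiplication operators on `H²` -/

/-- Holomorphic functions on the disc with square summable Taylor coefficients `a` and `b` which
differ by a factor `zⁿ` have shifted coefficients. -/
theorem HardySpace.coeff_eq_of_toFun_eq {a b : HardySpace} {n : ℕ}
    (h : ∀ z ∈ Metric.ball (0 : ℂ) 1,
      HardySpace.toFun a z = z ^ n * HardySpace.toFun b z) : a n = b 0 := by
  have hps : ∀ c : ℕ → ℂ, (∀ z ∈ Metric.ball (0 : ℂ) 1, Summable fun k => c k * z ^ k) →
      HasFPowerSeriesAt (fun z => ∑' k, c k * z ^ k)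
        (FormalMultilinearSeries.ofScalars ℂ c) 0 := by
    intro c hc
    rw [hasFPowerSeriesAt_iff]
    filter_upwards [Metric.ball_mem_nhds (0 : ℂ) one_pos] with z hz
    simpa [FormalMultilinearSeries.coeff_ofScalars, mul_comm] using (hc z hz).hasSum
  have hb : ∀ z ∈ Metric.ball (0 : ℂ) 1,
      HasSum (fun k => (if n ≤ k then b (k - n) else 0) * z ^ k)
        (z ^ n * HardySpace.toFun b z) := by
    intro z hz
    have h1 := (HardySpace.summable b hz).hasSum.mul_left (z ^ n)
    rw [← hasSum_nat_add_iff' n, Finset.sum_eq_zero (fun k hk => by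
      rw [if_neg (by simpa using hk), zero_mul]), sub_zero]
    refine h1.congr_fun fun k => ?_
    simp [pow_add]; ring
  have h1 := hps a fun z hz => HardySpace.summable a hz
  have h2 := hps (fun k => if n ≤ k then b (k - n) else 0) fun z hz => (hb z hz).summable
  have heq : (fun z => ∑' k, a k * z ^ k) =ᶠ[𝓝 0]
      fun z => ∑' k, (if n ≤ k then b (k - n) else 0) * z ^ k := by
    filter_upwards [Metric.ball_mem_nhds (0 : ℂ) one_pos] with z hz
    rw [(hb z hz).tsum_eq, ← h z hz, HardySpace.toFun]
  have h3 := congrArg (fun s => FormalMultilinearSeries.coeff s n)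
    (h1.eq_formalMultilinearSeries_of_eventually h2 heq)
  simpa [FormalMultilinearSeries.coeff_ofScalars] using h3

theorem not_hasGleasonWhitney_hinfHardy :
    ¬ HasGleasonWhitney (bhPairing HardySpace) hinfHardy ⊤ le_top := by
  let e : ℕ → HardySpace := fun n => lp.single 2 n 1
  have he : ∀ n, ∀ z : ℂ, HardySpace.toFun (e n) z = z ^ n := by
    intro n z
    rw [HardySpace.toFun, tsum_eq_single n]
    · simp [e]
    · intro k hk
      simp [e, lp.single_apply, Pi.single_eq_of_ne hk]
  have hinner : ∀ n (a : HardySpace), inner ℂ (e n) a = a n := by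
    intro n a
    simp [e, lp.inner_single_left]
  refine not_hasGleasonWhitney_of_orthonormal (u := e) ?_
    ⟨1, ⟨differentiableOn_const 1, 1, by simp⟩, fun u z _ => by simp⟩ ?_
  · rw [orthonormal_iff_ite]
    intro m n
    rw [hinner]
    simp [e, lp.single_apply, Pi.single_apply]
  · rintro T ⟨f, -, hf⟩ n
    rw [hinner, hinner]
    refine HardySpace.coeff_eq_of_toFun_eq fun z hz => ?_
    rw [hf _ z hz, hf _ z hz, he, he, pow_zero, mul_one, mul_comm]

/-! ### Multiplication operators on `L²[0,1]` -/

theorem integral_unitInterval (f : ℝ → ℂ) :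
    ∫ t : unitInterval, f t = ∫ t in (0 : ℝ)..1, f t := by
  rw [intervalIntegral.integral_of_le zero_le_one, ← integral_Icc_eq_integral_Ioc]
  exact integral_subtype_comap measurableSet_Icc f

/-- The character `t ↦ exp (2 π i n t)` on the unit interval. -/
noncomputable def unitIntervalCharacter (n : ℕ) : C(unitInterval, ℂ) where
  toFun t := Complex.exp (2 * Real.pi * Complex.I * n * (t : ℝ))

theorem star_unitIntervalCharacter_mul_self (n : ℕ) (t : unitInterval) :
    star (unitIntervalCharacter n t) * unitIntervalCharacter n t = 1 := by
  simp only [unitIntervalCharacter, ContinuousMap.coe_mk, Complex.star_def, ← Complex.exp_conj,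
    ← Complex.exp_add]
  rw [Complex.exp_eq_one_iff]
  exact ⟨0, by simp [Complex.conj_ofNat]⟩

/-- The characters as elements of `L²[0,1]`. -/
noncomputable def unitIntervalCharacterLp (n : ℕ) : L2I :=
  ContinuousMap.toLp 2 volume ℂ (unitIntervalCharacter n)

theorem coeFn_unitIntervalCharacterLp (n : ℕ) :
    unitIntervalCharacterLp n =ᵐ[volume] unitIntervalCharacter n :=
  ContinuousMap.coeFn_toLp volume (unitIntervalCharacter n)

theorem inner_unitIntervalCharacterLp (n : ℕ) (g : L2I) :
    inner ℂ (unitIntervalCharacterLp n) g = ∫ t, g t * star (unitIntervalCharacter n t) := by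
  rw [L2.inner_def]
  refine integral_congr_ae ?_
  filter_upwards [coeFn_unitIntervalCharacterLp n] with t ht
  rw [ht]
  rfl

theorem orthonormal_unitIntervalCharacterLp : Orthonormal ℂ unitIntervalCharacterLp := by
  rw [orthonormal_iff_ite]
  intro m n
  rw [inner_unitIntervalCharacterLp]
  have h : ∫ t, unitIntervalCharacterLp n t * star (unitIntervalCharacter m t) =
      ∫ t : unitInterval,
        Complex.exp ((2 * Real.pi * Complex.I * ((n : ℂ) - m)) * ((t : ℝ) : ℂ)) := by
    refine integral_congr_ae ?_
    filter_upwards [coeFn_unitIntervalCharacterLp n] with t ht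
    rw [ht]
    simp only [unitIntervalCharacter, ContinuousMap.coe_mk, Complex.star_def, ← Complex.exp_conj,
      ← Complex.exp_add]
    congr 1
    simp [Complex.conj_ofNat]
    ring
  rw [h, integral_unitInterval
    (fun t => Complex.exp ((2 * Real.pi * Complex.I * ((n : ℂ) - m)) * (t : ℂ)))]
  split_ifs with hmn
  · simp [hmn]
  · have hne : (n : ℂ) - m ≠ 0 := sub_ne_zero.2 (by exact_mod_cast Ne.symm hmn)
    rw [integral_exp_mul_complex (mul_ne_zero Complex.two_pi_I_ne_zero hne)]
    have : Complex.exp (2 * Real.pi * Complex.I * ((n : ℂ) - m)) = 1 :=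
      Complex.exp_eq_one_iff.2 ⟨(n : ℤ) - m, by push_cast; ring⟩
    simp [this]

theorem not_hasGleasonWhitney_multiplicationOperators :
    ¬ HasGleasonWhitney (bhPairing L2I) multiplicationOperators ⊤ le_top := by
  refine not_hasGleasonWhitney_of_orthonormal orthonormal_unitIntervalCharacterLp
    ⟨Lp.const ∞ volume 1, fun g => ?_⟩ ?_
  · filter_upwards [Lp.coeFn_const (p := ∞) (μ := (volume : Measure unitInterval)) (1 : ℂ)]
      with t ht
    rw [ht, Function.const_apply, one_mul, ContinuousLinearMap.id_apply]
  · rintro T ⟨f, hf⟩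
    have key : ∀ n, inner ℂ (unitIntervalCharacterLp n) (T (unitIntervalCharacterLp n)) =
        ∫ t, f t := by
      intro n
      rw [inner_unitIntervalCharacterLp]
      refine integral_congr_ae ?_
      filter_upwards [hf (unitIntervalCharacterLp n), coeFn_unitIntervalCharacterLp n] with t h1 h2
      rw [h1, h2, mul_assoc, mul_comm (unitIntervalCharacter n t),
        star_unitIntervalCharacter_mul_self, mul_one]
    intro n
    rw [key, key]

/-! ### Functionals on `L^∞` given by densities -/

section Linfty

variable {S : Type*} [MeasurableSpace S] {μ : Measure S}

theorem ae_norm_le_norm (F : Lp ℂ ∞ μ) : ∀ᵐ s ∂μ, ‖F s‖ ≤ ‖F‖ := by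
  filter_upwards [ae_le_eLpNormEssSup (f := F) (μ := μ)] with s hs
  rw [Lp.norm_def, eLpNorm_exponent_top, ← toReal_enorm]
  refine ENNReal.toReal_mono ?_ hs
  rw [← eLpNorm_exponent_top]
  exact Lp.eLpNorm_ne_top F

theorem norm_le_of_ae_norm_le [IsFiniteMeasure μ] {F : Lp ℂ ∞ μ} {C : ℝ} (hC : 0 ≤ C)
    (h : ∀ᵐ s ∂μ, ‖F s‖ ≤ C) : ‖F‖ ≤ C := by
  simpa using Lp.norm_le_of_ae_bound hC h

theorem integrable_linfty_mul (F : Lp ℂ ∞ μ) (g : Lp ℂ 1 μ) :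
    Integrable (fun s => F s * g s) μ :=
  (L1.integrable_coeFn g).bdd_mul (Lp.aestronglyMeasurable F) (ae_norm_le_norm F)

/-- The functional on `L^∞(μ)` with density `g ∈ L^1(μ)`. -/
noncomputable def densityFunctional (g : Lp ℂ 1 μ) : Lp ℂ ∞ μ →L[ℂ] ℂ :=
  LinearMap.mkContinuous
    { toFun := fun F => linftyPairing μ F g
      map_add' := fun F G => by
        rw [linftyPairing, linftyPairing, linftyPairing,
          ← integral_add (integrable_linfty_mul F g) (integrable_linfty_mul G g)]
        refine integral_congr_ae ?_
        filter_upwards [Lp.coeFn_add F G] with s hs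
        rw [hs, Pi.add_apply, add_mul]
      map_smul' := fun c F => by
        rw [linftyPairing, linftyPairing, RingHom.id_apply, smul_eq_mul, ← integral_const_mul]
        refine integral_congr_ae ?_
        filter_upwards [Lp.coeFn_smul c F] with s hs
        rw [hs, Pi.smul_apply, smul_eq_mul, mul_assoc] }
    ‖g‖ fun F => by
      change ‖∫ s, F s * g s ∂μ‖ ≤ _
      rw [L1.norm_eq_integral_norm, mul_comm, ← integral_const_mul]
      refine norm_integral_le_of_norm_le ((L1.integrable_coeFn g).norm.const_mul _) ?_
      filter_upwards [ae_norm_le_norm F] with s hs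
      rw [norm_mul]
      gcongr

theorem densityFunctional_apply (g : Lp ℂ 1 μ) (F : Lp ℂ ∞ μ) :
    densityFunctional g F = linftyPairing μ F g := rfl

theorem norm_densityFunctional_le (g : Lp ℂ 1 μ) : ‖densityFunctional g‖ ≤ ‖g‖ :=
  LinearMap.mkContinuous_norm_le _ (norm_nonneg g) _

/-- Bounded sequences which converge almost everywhere converge in the weak-* topology. -/
theorem tendsto_linftyPairing {u : ℕ → Lp ℂ ∞ μ} {F : Lp ℂ ∞ μ} {C : ℝ}
    (hu : ∀ n, ∀ᵐ s ∂μ, ‖u n s‖ ≤ C)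
    (hF : ∀ᵐ s ∂μ, Tendsto (fun n => u n s) atTop (𝓝 (F s))) (g : Lp ℂ 1 μ) :
    Tendsto (fun n => linftyPairing μ (u n) g) atTop (𝓝 (linftyPairing μ F g)) := by
  refine tendsto_integral_of_dominated_convergence (fun s => C * ‖g s‖)
    (fun n => (integrable_linfty_mul (u n) g).aestronglyMeasurable)
    ((L1.integrable_coeFn g).norm.const_mul C) (fun n => ?_) ?_
  · filter_upwards [hu n] with s hs
    rw [norm_mul]
    gcongr
  · filter_upwards [hF] with s hs
    exact hs.mul_const _

variable [IsFiniteMeasure μ]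

/-- The functional on `L^∞(μ)` of averaging over the measurable set `A`. -/
noncomputable def averageFunctional (μ : Measure S) [IsFiniteMeasure μ] {A : Set S}
    (hA : MeasurableSet A) : Lp ℂ ∞ μ →L[ℂ] ℂ :=
  densityFunctional (indicatorConstLp 1 hA (measure_ne_top μ A) ((μ.real A)⁻¹ : ℂ))

theorem averageFunctional_apply {A : Set S} (hA : MeasurableSet A) (F : Lp ℂ ∞ μ) :
    averageFunctional μ hA F = (μ.real A : ℂ)⁻¹ * ∫ s in A, F s ∂μ := by
  rw [averageFunctional, densityFunctional_apply, linftyPairing, ← integral_indicator hA,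
    ← integral_const_mul]
  refine integral_congr_ae ?_
  filter_upwards [indicatorConstLp_coeFn (p := 1) (hs := hA) (hμs := measure_ne_top μ A)
    (c := ((μ.real A)⁻¹ : ℂ))] with s hs
  rw [hs]
  by_cases h : s ∈ A <;> simp [h, mul_comm]

theorem norm_averageFunctional_le {A : Set S} (hA : MeasurableSet A) :
    ‖averageFunctional μ hA‖ ≤ 1 := by
  refine (norm_densityFunctional_le _).trans ?_
  rw [norm_indicatorConstLp one_ne_zero ENNReal.one_ne_top]
  simpa [abs_of_nonneg] using inv_mul_le_one (a := μ.real A)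

/-- If the averages over infinitely many disjoint sets `A n` coincide on `X`, a limit of these
averages is a Hahn–Banach extension from `X` which is not absolutely continuous: it takes the value
`1` at the indicators of the unions `⋃ n ≥ m, A n`, which decrease to zero. -/
theorem not_hasGleasonWhitney_of_averages {X : Submodule ℂ (Lp ℂ ∞ μ)} {A : ℕ → Set S}
    (hA : ∀ n, MeasurableSet (A n)) (hdisj : Pairwise (Function.onFun Disjoint A))
    (hpos : ∀ n, μ (A n) ≠ 0) (h1 : Lp.const ∞ μ 1 ∈ X)
    (hX : ∀ F ∈ X, ∃ c, ∀ n, ∫ s in A n, F s ∂μ = μ.real (A n) * c) :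
    ¬ HasGleasonWhitney (linftyPairing μ) X ⊤ le_top := by
  have hne : ∀ n, (μ.real (A n) : ℂ) ≠ 0 := fun n => by
    simpa [Measure.real, ENNReal.toReal_eq_zero_iff] using hpos n
  have hB : ∀ m, MeasurableSet (⋃ n ≥ m, A n) := fun m =>
    MeasurableSet.iUnion fun n => MeasurableSet.iUnion fun _ => hA n
  let u : ℕ → Lp ℂ ∞ μ := fun m =>
    indicatorConstLp ∞ (hB m) (measure_ne_top μ _) (1 : ℂ)
  have hu : ∀ m, u m =ᵐ[μ] (⋃ n ≥ m, A n).indicator fun _ => (1 : ℂ) := fun m =>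
    indicatorConstLp_coeFn
  refine not_hasGleasonWhitney_of_sequence (ψ := fun n => averageFunctional μ (hA n))
    (densityFunctional_apply _) (fun n => norm_averageFunctional_le (hA n)) ?_ h1 ?_ ?_
    (u := u) (y := 0) (a := 1) (b := 0) ?_ ?_ (fun n => map_zero _) one_ne_zero
  · intro F hF n
    obtain ⟨c, hc⟩ := hX F hF
    rw [averageFunctional_apply, averageFunctional_apply, hc, hc, inv_mul_cancel_left₀ (hne n),
      inv_mul_cancel_left₀ (hne 0)]
  · refine norm_le_of_ae_norm_le zero_le_one ?_
    filter_upwards [Lp.coeFn_const (p := ∞) (μ := μ) (1 : ℂ)] with s hs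
    rw [hs]
    simp
  · rw [averageFunctional_apply, integral_congr_ae (ae_restrict_of_ae
      (Lp.coeFn_const (p := ∞) (μ := μ) (1 : ℂ)))]
    simp [inv_mul_cancel₀ (hne 0)]
  · refine tendsto_linftyPairing (C := 1) (fun m => ?_) ?_
    · filter_upwards [hu m] with s hs
      rw [hs]
      exact (norm_indicator_le_norm_self _ _).trans (by simp)
    · filter_upwards [ae_all_iff.2 hu, Lp.coeFn_zero ℂ ∞ μ] with s hs h0
      rw [h0, Pi.zero_apply]
      refine tendsto_const_nhds.congr' ?_
      -- the point `s` belongs to at most one of the disjoint sets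
      by_cases h : ∃ k, s ∈ A k
      · obtain ⟨k, hk⟩ := h
        filter_upwards [eventually_gt_atTop k] with m hm
        rw [hs m, Set.indicator_of_notMem]
        simp only [Set.mem_iUnion, not_exists]
        intro n hn hsn
        exact (hdisj (ne_of_gt (lt_of_lt_of_le hm hn))).le_bot ⟨hsn, hk⟩
      · push Not at h
        refine Eventually.of_forall fun m => ?_
        change 0 = u m s
        rw [hs m, Set.indicator_of_notMem]
        simpa using fun n _ => h n
  · intro m n hmn
    have hsub : A n ⊆ ⋃ k ≥ m, A k := Set.subset_biUnion_of_mem (u := A) hmn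
    rw [averageFunctional_apply, integral_congr_ae (ae_restrict_of_ae (hu m)),
      setIntegral_congr_fun (g := fun _ => (1 : ℂ)) (hA n)
        fun s hs => Set.indicator_of_mem (hsub hs) _]
    simp [inv_mul_cancel₀ (hne n)]

end Linfty

/-! ### Arclength measure on the circle -/

instance : Fact (0 < 2 * Real.pi) := ⟨Real.two_pi_pos⟩

theorem circleMeasure_eq_map :
    circleMeasure = ENNReal.ofReal (2 * Real.pi)⁻¹ •
      (volume : Measure (AddCircle (2 * Real.pi))).map AddCircle.homeomorphCircle' := by
  have h : (fun t : ℝ => Circle.exp t) =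
      AddCircle.homeomorphCircle' ∘ ((↑) : ℝ → AddCircle (2 * Real.pi)) := by
    funext t
    rfl
  have h2 := (AddCircle.measurePreserving_mk (2 * Real.pi) 0).map_eq
  rw [zero_add] at h2
  rw [circleMeasure, h, ← h2,
    Measure.map_map AddCircle.homeomorphCircle'.continuous.measurable
      (AddCircle.measurable_mk' (a := 2 * Real.pi))]

instance : IsProbabilityMeasure circleMeasure := by
  constructor
  rw [circleMeasure, Measure.smul_apply, Measure.map_apply (by fun_prop) MeasurableSet.univ]
  simp only [Set.preimage_univ, Measure.restrict_apply_univ, Real.volume_Ioc, sub_zero, smul_eq_mul]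
  rw [← ENNReal.ofReal_mul (by positivity), inv_mul_cancel₀ (by positivity), ENNReal.ofReal_one]

instance : Measure.IsMulLeftInvariant circleMeasure := by
  constructor
  intro c
  obtain ⟨x, rfl⟩ := AddCircle.homeomorphCircle'.surjective c
  have h : (fun z => AddCircle.homeomorphCircle' x * z) ∘ AddCircle.homeomorphCircle' =
      AddCircle.homeomorphCircle' ∘ fun y => x + y := by
    funext y
    exact (Real.Angle.toCircle_add x y).symm
  rw [circleMeasure_eq_map, Measure.map_smul,
    Measure.map_map (measurable_const_mul _) AddCircle.homeomorphCircle'.continuous.measurable, h,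
    ← Measure.map_map AddCircle.homeomorphCircle'.continuous.measurable (measurable_const_add x),
    map_add_left_eq_self]

instance : Measure.IsHaarMeasure circleMeasure :=
  Measure.isHaarMeasure_of_isCompact_nonempty_interior circleMeasure Set.univ isCompact_univ
    (by simp) (by simp) (by simp)

/-- The mean value property. -/
theorem integral_circleMeasure {h : ℂ → ℂ} (hh : DiffContOnCl ℂ h (Metric.ball 0 1)) :
    ∫ ζ : Circle, h ζ ∂circleMeasure = h 0 := by
  have hc : Continuous fun ζ : Circle => h ζ := by
    have := hh.continuousOn
    rw [closure_ball (0 : ℂ) one_ne_zero] at this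
    exact this.comp_continuous continuous_subtype_val fun ζ => by simp [Circle.norm_coe]
  have h1 := DiffContOnCl.circleAverage (R := 1) (by simpa using hh)
  rw [← h1, Real.circleAverage_def, intervalIntegral.integral_of_le (by positivity), circleMeasure,
    integral_smul_measure, integral_map (by fun_prop) hc.aestronglyMeasurable,
    ENNReal.toReal_ofReal (by positivity)]
  simp [circleMap]

/-! ### Averages over rotation invariant sets -/

section Rotation

variable {S : Type*} [MeasurableSpace S] {μ : Measure S} [IsFiniteMeasure μ]

/-- If the mean of `g` over each orbit of a measure preserving circle action is `c`, then so is its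
mean over each invariant set, by Fubini's theorem. -/
theorem setIntegral_eq_of_circle_mean {a : Circle → S → S} (ha : Measurable (Function.uncurry a))
    (haμ : ∀ ζ, MeasurePreserving (a ζ) μ μ) {A : Set S} (hA : MeasurableSet A)
    (haA : ∀ ζ, a ζ ⁻¹' A = A) {g : S → ℂ} (hg : Measurable g) {C : ℝ} (hC : ∀ s, ‖g s‖ ≤ C)
    {c : ℂ} (hc : ∀ s, ∫ ζ, g (a ζ s) ∂circleMeasure = c) :
    ∫ s in A, g s ∂μ = μ.real A * c := by
  have haμA : ∀ ζ, MeasurePreserving (a ζ) (μ.restrict A) (μ.restrict A) := fun ζ => by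
    simpa [haA ζ] using (haμ ζ).restrict_preimage hA
  have h1 : ∀ ζ, ∫ s in A, g (a ζ s) ∂μ = ∫ s in A, g s ∂μ := fun ζ => by
    rw [← integral_map (haμA ζ).aemeasurable hg.aestronglyMeasurable, (haμA ζ).map_eq]
  have hint : Integrable (Function.uncurry fun ζ s => g (a ζ s))
      (circleMeasure.prod (μ.restrict A)) :=
    Integrable.of_bound (hg.comp ha).aestronglyMeasurable C
      (Eventually.of_forall fun _ => hC _)
  have h2 := integral_integral_swap hint
  simp only [h1, hc] at h2
  simpa using h2

/-- The Gleason–Whitney property fails if each element of `X` has the same mean over all sets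
`h ⁻¹' I`, where `h` takes values in the intervals `(1 / (n + 2), 1 / (n + 1))` on sets of positive
measure. -/
theorem not_hasGleasonWhitney_of_fibers {X : Submodule ℂ (Lp ℂ ∞ μ)} {h : S → ℝ}
    (hh : Measurable h)
    (hpos : ∀ n : ℕ, μ (h ⁻¹' Set.Ioo (1 / ((n + 1 : ℕ) + 1 : ℝ)) (1 / ((n : ℝ) + 1))) ≠ 0)
    (h1 : Lp.const ∞ μ 1 ∈ X)
    (hX : ∀ F ∈ X, ∃ c, ∀ I : Set ℝ, MeasurableSet I →
      ∫ s in h ⁻¹' I, F s ∂μ = μ.real (h ⁻¹' I) * c) :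
    ¬ HasGleasonWhitney (linftyPairing μ) X ⊤ le_top := by
  have hanti : Antitone fun n : ℕ => 1 / ((n : ℝ) + 1) :=
    antitone_nat_of_succ_le fun n => Nat.one_div_le_one_div n.le_succ
  refine not_hasGleasonWhitney_of_averages
    (A := fun n : ℕ => h ⁻¹' Set.Ioo (1 / ((n + 1 : ℕ) + 1 : ℝ)) (1 / ((n : ℝ) + 1)))
    (fun n => hh measurableSet_Ioo)
    (fun m n hmn => (hanti.pairwise_disjoint_on_Ioo_succ hmn).preimage h) hpos h1 fun F hF => ?_
  obtain ⟨c, hc⟩ := hX F hF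
  exact ⟨c, fun n => hc _ measurableSet_Ioo⟩

/-- The mean value property on the disc `{w • v | ‖w‖ ≤ 1}`. -/
theorem integral_circle_smul {E : Type*} [NormedAddCommGroup E] [NormedSpace ℂ E] {U : Set E}
    {f : E → ℂ} (hf : DifferentiableOn ℂ f U) {v : E} (hv : ∀ w : ℂ, ‖w‖ ≤ 1 → w • v ∈ U) :
    ∫ ζ : Circle, f ((ζ : ℂ) • v) ∂circleMeasure = f 0 := by
  have h : DiffContOnCl ℂ (fun w : ℂ => f (w • v)) (Metric.ball 0 1) := by
    refine DifferentiableOn.diffContOnCl ?_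
    rw [closure_ball (0 : ℂ) one_ne_zero]
    exact hf.comp (by fun_prop) fun w hw => hv w (by simpa using hw)
  simpa using integral_circleMeasure h

theorem ofReal_smul_smul_mem {E : Type*} [NormedAddCommGroup E] [NormedSpace ℂ E] {U : Set E}
    {x : E} (hx : ∀ w : ℂ, ‖w‖ < 1 → w • x ∈ U) {r : ℝ} (hr : r ∈ Set.Ico 0 1) {w : ℂ}
    (hw : ‖w‖ ≤ 1) : w • (r : ℂ) • x ∈ U := by
  rw [smul_smul]
  refine hx _ ?_
  rw [norm_mul, Complex.norm_real, Real.norm_of_nonneg hr.1]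
  exact (mul_le_of_le_one_left hr.1 hw).trans_lt hr.2

/-- The radii `1 - 1 / (n + 1)`, which increase to `1`. -/
noncomputable def radius (n : ℕ) : ℝ := 1 - 1 / ((n : ℝ) + 1)

theorem radius_mem (n : ℕ) : radius n ∈ Set.Ico (0 : ℝ) 1 := by
  have h1 : 1 / ((n : ℝ) + 1) ≤ 1 := by
    rw [div_le_one (by positivity)]
    linarith [(Nat.cast_nonneg n : (0 : ℝ) ≤ n)]
  have h2 : 0 < 1 / ((n : ℝ) + 1) := by positivity
  constructor <;> unfold radius <;> linarith

theorem tendsto_radius : Tendsto radius atTop (𝓝[<] 1) := by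
  refine tendsto_nhdsWithin_iff.2 ⟨?_, Eventually.of_forall fun n => (radius_mem n).2⟩
  simpa only [sub_zero, ← radius.eq_def] using
    (tendsto_const_nhds (x := (1 : ℝ))).sub (tendsto_one_div_add_atTop_nhds_zero_nat (𝕜 := ℝ))

/-- The case of boundary values of bounded holomorphic functions, on a space `S` with a measure
preserving circle action which corresponds to scalar multiplication. The values of an invariant
function `h` provide infinitely many disjoint invariant sets of positive measure. -/
theorem not_hasGleasonWhitney_radialBoundaryValues {E : Type*} [NormedAddCommGroup E]
    [NormedSpace ℂ E] [TopologicalSpace S] [OpensMeasurableSpace S] {ι : S → E}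
    (hι : Continuous ι) {U : Set E} (hU : ∀ s, ∀ w : ℂ, ‖w‖ < 1 → w • ι s ∈ U)
    {a : Circle → S → S} (ha : Measurable (Function.uncurry a))
    (haμ : ∀ ζ, MeasurePreserving (a ζ) μ μ) (hιa : ∀ ζ s, ι (a ζ s) = (ζ : ℂ) • ι s)
    {h : S → ℝ} (hh : Measurable h) (hha : ∀ ζ s, h (a ζ s) = h s)
    (hpos : ∀ n : ℕ, μ (h ⁻¹' Set.Ioo (1 / ((n + 1 : ℕ) + 1 : ℝ)) (1 / ((n : ℝ) + 1))) ≠ 0) :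
    ¬ HasGleasonWhitney (linftyPairing μ) (radialBoundaryValues μ ι U) ⊤ le_top := by
  refine not_hasGleasonWhitney_of_fibers hh hpos
    ⟨1, ⟨differentiableOn_const 1, 1, by simp⟩, ?_⟩ ?_
  · filter_upwards [Lp.coeFn_const (p := ∞) (μ := μ) (1 : ℂ)] with s hs
    rw [hs]
    exact tendsto_const_nhds
  rintro F ⟨f, ⟨hf, C, hC⟩, hF⟩
  refine ⟨f 0, fun I hI => ?_⟩
  have hmem : ∀ n s, (radius n : ℂ) • ι s ∈ U := fun n s => by
    simpa using ofReal_smul_smul_mem (hU s) (radius_mem n) (w := 1) (by simp)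
  have hcont : ∀ n, Continuous fun s => f ((radius n : ℂ) • ι s) := fun n =>
    hf.continuousOn.comp_continuous (by fun_prop) (hmem n)
  have hmean : ∀ n, ∫ s in h ⁻¹' I, f ((radius n : ℂ) • ι s) ∂μ = μ.real (h ⁻¹' I) * f 0 := by
    intro n
    refine setIntegral_eq_of_circle_mean ha haμ (hh hI) (fun ζ => by ext s; simp [hha])
      (hcont n).measurable (fun s => hC _ (hmem n s)) fun s => ?_
    simp only [hιa, smul_comm (radius n : ℂ)]
    exact integral_circle_smul hf fun w hw => ofReal_smul_smul_mem (hU s) (radius_mem n) hw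
  have hlim : Tendsto (fun n => ∫ s in h ⁻¹' I, f ((radius n : ℂ) • ι s) ∂μ) atTop
      (𝓝 (∫ s in h ⁻¹' I, F s ∂μ)) := by
    refine tendsto_integral_of_dominated_convergence (fun _ => C)
      (fun n => (hcont n).aestronglyMeasurable) (integrable_const C)
      (fun n => Eventually.of_forall fun s => hC _ (hmem n s)) (ae_restrict_of_ae ?_)
    filter_upwards [hF] with s hs
    exact hs.comp tendsto_radius
  simp only [hmean] at hlim
  exact tendsto_nhds_unique hlim tendsto_const_nhds

end Rotation

theorem one_div_succ_Ioo_nonempty (n : ℕ) :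
    ∃ t ∈ Set.Ioo (1 / ((n + 1 : ℕ) + 1 : ℝ)) (1 / ((n : ℝ) + 1)), 0 < t ∧ t < 1 := by
  have h : 1 / ((n + 1 : ℕ) + 1 : ℝ) < 1 / ((n : ℝ) + 1) :=
    Nat.one_div_lt_one_div n.lt_succ_self
  obtain ⟨t, h1, h2⟩ := exists_between h
  have h3 : 1 / ((n : ℝ) + 1) ≤ 1 := by
    rw [div_le_one (by positivity)]
    linarith [(Nat.cast_nonneg n : (0 : ℝ) ≤ n)]
  exact ⟨t, ⟨h1, h2⟩, lt_trans (by positivity) h1, h2.trans_le h3⟩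

/-! ### The polydisc -/

instance (d : ℕ) : IsProbabilityMeasure (torusMeasure d) := by
  unfold torusMeasure; infer_instance

instance (d : ℕ) : (torusMeasure d).IsOpenPosMeasure := by
  unfold torusMeasure; infer_instance

theorem not_hasGleasonWhitney_hinfPolydisc {d : ℕ} (hd : 2 ≤ d) :
    ¬ HasGleasonWhitney (linftyPairing (torusMeasure d)) (hinfPolydisc d) ⊤ le_top := by
  let i : Fin d := ⟨0, by omega⟩
  let j : Fin d := ⟨1, by omega⟩
  have hh : Continuous fun ζ : Fin d → Circle => ((ζ i / ζ j : Circle) : ℂ).re :=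
    Complex.continuous_re.comp (continuous_subtype_val.comp
      ((continuous_apply i).div' (continuous_apply j)))
  refine not_hasGleasonWhitney_radialBoundaryValues (a := fun ζ s k => ζ * s k)
    (h := fun ζ => ((ζ i / ζ j : Circle) : ℂ).re)
    (by fun_prop) ?_ ?_ ?_ (fun ζ s => rfl) hh.measurable ?_ ?_
  · intro s w hw k
    simpa [Circle.norm_coe] using hw
  · exact (by fun_prop : Continuous fun x : Circle × (Fin d → Circle) =>
      fun k => x.1 * x.2 k).measurable
  · exact fun ζ => measurePreserving_pi _ _ fun _ => measurePreserving_mul_left circleMeasure ζ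
  · intro ζ s
    simp only [mul_div_mul_left_eq_div]
  · intro n
    obtain ⟨t, ht, h0, h1⟩ := one_div_succ_Ioo_nonempty n
    refine ((isOpen_Ioo.preimage hh).measure_pos _ ⟨Function.update 1 i
      (Circle.exp (Real.arccos t)), ?_⟩).ne'
    have hij : j ≠ i := by simp [i, j]
    have : ((Circle.exp (Real.arccos t) : Circle) : ℂ).re = t := by
      rw [Circle.coe_exp, Complex.exp_ofReal_mul_I_re, Real.cos_arccos (by linarith) h1.le]
    rw [Set.mem_preimage, Function.update_self, Function.update_of_ne hij, Pi.one_apply, div_one,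
      this]
    exact ht

/-! ### The ball -/

/-- Multiplication by a complex number of modulus one, as a real linear isometry. -/
noncomputable def circleIsometry (E : Type*) [NormedAddCommGroup E] [NormedSpace ℂ E]
    [NormedSpace ℝ E] [IsScalarTower ℝ ℂ E] (ζ : Circle) : E ≃ₗᵢ[ℝ] E where
  toLinearEquiv := (LinearEquiv.smulOfNeZero ℂ E (ζ : ℂ) (Circle.coe_ne_zero ζ)).restrictScalars ℝ
  norm_map' x := by
    change ‖(ζ : ℂ) • x‖ = ‖x‖
    rw [norm_smul, Circle.norm_coe, one_mul]

theorem circleIsometry_apply {E : Type*} [NormedAddCommGroup E] [NormedSpace ℂ E]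
    [NormedSpace ℝ E] [IsScalarTower ℝ ℂ E] (ζ : Circle) (x : E) :
    circleIsometry E ζ x = (ζ : ℂ) • x := rfl

open scoped Pointwise in
/-- The surface measure of the sphere is invariant under linear isometries. -/
theorem measurePreserving_toSphere {E : Type*} [NormedAddCommGroup E] [InnerProductSpace ℝ E]
    [FiniteDimensional ℝ E] [MeasurableSpace E] [BorelSpace E] (L : E ≃ₗᵢ[ℝ] E)
    {a : Metric.sphere (0 : E) 1 → Metric.sphere (0 : E) 1} (ha : Measurable a)
    (haL : ∀ s, (a s : E) = L s) :
    MeasurePreserving a (volume : Measure E).toSphere (volume : Measure E).toSphere := by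
  refine ⟨ha, Measure.ext fun s hs => ?_⟩
  rw [Measure.map_apply ha hs, Measure.toSphere_apply' _ (ha hs), Measure.toSphere_apply' _ hs]
  have h : Set.Ioo (0 : ℝ) 1 • ((↑) '' (a ⁻¹' s) : Set E) =
      L ⁻¹' (Set.Ioo (0 : ℝ) 1 • ((↑) '' s : Set E)) := by
    ext x
    simp only [Set.mem_smul, Set.mem_image, Set.mem_preimage]
    constructor
    · rintro ⟨r, hr, _, ⟨y, hy, rfl⟩, rfl⟩
      exact ⟨r, hr, _, ⟨a y, hy, rfl⟩, by rw [haL, map_smul]⟩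
    · rintro ⟨r, hr, _, ⟨y, hy, rfl⟩, hx⟩
      have hz : L.symm y ∈ Metric.sphere (0 : E) 1 := by simp
      refine ⟨r, hr, _, ⟨⟨L.symm y, hz⟩, ?_, rfl⟩, ?_⟩
      · have : a ⟨L.symm y, hz⟩ = y := Subtype.ext (by rw [haL]; simp)
        rwa [this]
      · apply L.injective
        rw [← hx, map_smul]
        simp
  rw [h, L.measurePreserving.measure_preimage_emb L.toHomeomorph.measurableEmbedding]

instance (d : ℕ) : IsFiniteMeasure (sphereMeasure d) := by
  unfold sphereMeasure
  infer_instance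

theorem not_hasGleasonWhitney_hinfBall {d : ℕ} (hd : 2 ≤ d) :
    ¬ HasGleasonWhitney (linftyPairing (sphereMeasure d)) (hinfBall d) ⊤ le_top := by
  let i : Fin d := ⟨0, by omega⟩
  let j : Fin d := ⟨1, by omega⟩
  have hij : j ≠ i := by simp [i, j]
  have hh : Continuous fun ζ : Sph d => ‖(ζ : EuclideanSpace ℂ (Fin d)) i‖ := by fun_prop
  let a : Circle → Sph d → Sph d := fun ζ s =>
    ⟨(ζ : ℂ) • (s : EuclideanSpace ℂ (Fin d)), by
      rw [mem_sphere_zero_iff_norm, norm_smul, Circle.norm_coe, one_mul,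
        mem_sphere_zero_iff_norm.1 s.2]⟩
  have ha : Continuous (Function.uncurry a) :=
    Continuous.subtype_mk (by fun_prop) _
  refine not_hasGleasonWhitney_radialBoundaryValues (a := a)
    (h := fun ζ => ‖(ζ : EuclideanSpace ℂ (Fin d)) i‖)
    continuous_subtype_val ?_ ha.measurable ?_ (fun ζ s => rfl) hh.measurable ?_ ?_
  · intro s w hw
    rw [mem_ball_zero_iff, norm_smul, mem_sphere_zero_iff_norm.1 s.2, mul_one]
    exact hw
  · intro ζ
    exact (measurePreserving_toSphere (circleIsometry _ ζ)
      (ha.comp (Continuous.prodMk_right ζ)).measurable fun s => rfl).smul_measure _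
  · intro ζ s
    simp [a, Circle.norm_coe]
  · intro n
    obtain ⟨t, ht, h0, h1⟩ := one_div_succ_Ioo_nonempty n
    have hx : (EuclideanSpace.single i (t : ℂ) +
        EuclideanSpace.single j (Real.sqrt (1 - t ^ 2) : ℂ) : EuclideanSpace ℂ (Fin d)) ∈ Metric.sphere (0 : EuclideanSpace ℂ (Fin d)) 1 := by
      rw [mem_sphere_zero_iff_norm, ← sq_eq_sq₀ (norm_nonneg _) zero_le_one,
        @norm_add_sq ℂ]
      have h3 : 0 ≤ 1 - t ^ 2 := by nlinarith
      have h4 : inner ℂ (EuclideanSpace.single i (t : ℂ))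
          (EuclideanSpace.single j (Real.sqrt (1 - t ^ 2) : ℂ)) = 0 := by
        rw [EuclideanSpace.inner_single_left]
        simp [hij.symm]
      rw [h4]
      simp [Real.sq_sqrt h3]
    have hxt : (⟨_, hx⟩ : Sph d) ∈ (fun ζ : Sph d => ‖(ζ : EuclideanSpace ℂ (Fin d)) i‖) ⁻¹'
        Set.Ioo (1 / ((n + 1 : ℕ) + 1 : ℝ)) (1 / ((n : ℝ) + 1)) := by
      simpa [hij.symm, abs_of_pos h0] using ht
    have h2 := (isOpen_Ioo.preimage hh).measure_pos
      (volume : Measure (EuclideanSpace ℂ (Fin d))).toSphere ⟨_, hxt⟩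
    rw [sphereMeasure, Measure.smul_apply, smul_eq_mul]
    exact mul_ne_zero (ENNReal.inv_ne_zero.2 (measure_ne_top _ _)) h2.ne'

/-! ### The disc with area measure -/

instance : IsFiniteMeasure areaMeasure := by
  constructor
  rw [areaMeasure, comap_subtype_coe_apply measurableSet_closedBall, Set.image_univ,
    Subtype.range_coe]
  exact measure_closedBall_lt_top

theorem not_hasGleasonWhitney_hinfArea :
    ¬ HasGleasonWhitney (linftyPairing areaMeasure) hinfArea ⊤ le_top := by
  have hh : Continuous fun z : Metric.closedBall (0 : ℂ) 1 => ‖(z : ℂ)‖ := by fun_prop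
  let a : Circle → Metric.closedBall (0 : ℂ) 1 → Metric.closedBall (0 : ℂ) 1 := fun ζ z =>
    ⟨(ζ : ℂ) * (z : ℂ), by
      rw [mem_closedBall_zero_iff, norm_mul, Circle.norm_coe, one_mul]
      exact mem_closedBall_zero_iff.1 z.2⟩
  have ha : Continuous (Function.uncurry a) :=
    Continuous.subtype_mk (by fun_prop) _
  have haμ : ∀ ζ, MeasurePreserving (a ζ) areaMeasure areaMeasure := by
    intro ζ
    have hm : Measurable (a ζ) := (ha.comp (Continuous.prodMk_right ζ)).measurable
    refine ⟨hm, Measure.ext fun s hs => ?_⟩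
    rw [Measure.map_apply hm hs, areaMeasure, comap_subtype_coe_apply measurableSet_closedBall,
      comap_subtype_coe_apply measurableSet_closedBall]
    have h : ((↑) '' (a ζ ⁻¹' s) : Set ℂ) = circleIsometry ℂ ζ ⁻¹' ((↑) '' s) := by
      ext z
      simp only [Set.mem_image, Set.mem_preimage, circleIsometry_apply]
      constructor
      · rintro ⟨y, hy, rfl⟩
        exact ⟨a ζ y, hy, rfl⟩
      · rintro ⟨y, hy, hz⟩
        have hz1 : z ∈ Metric.closedBall (0 : ℂ) 1 := by
          have := y.2
          rw [hz] at this
          simpa [Circle.norm_coe] using this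
        refine ⟨⟨z, hz1⟩, ?_, rfl⟩
        have : a ζ ⟨z, hz1⟩ = y := Subtype.ext hz.symm
        rwa [this]
    rw [h, (circleIsometry ℂ ζ).measurePreserving.measure_preimage_emb
      (circleIsometry ℂ ζ).toHomeomorph.measurableEmbedding]
  have hha : ∀ ζ z, ‖(a ζ z : ℂ)‖ = ‖(z : ℂ)‖ := fun ζ z => by simp [a, Circle.norm_coe]
  -- the boundary circle, on which the values of `f` play no role, is a null set
  have hnull : ∀ᵐ z : Metric.closedBall (0 : ℂ) 1 ∂areaMeasure, ‖(z : ℂ)‖ < 1 := by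
    rw [ae_iff, areaMeasure, comap_subtype_coe_apply measurableSet_closedBall]
    refine measure_mono_null ?_ (Measure.addHaar_sphere volume (0 : ℂ) 1)
    rintro _ ⟨z, hz, rfl⟩
    have h1 : ‖(z : ℂ)‖ ≤ 1 := mem_closedBall_zero_iff.1 z.2
    simpa using le_antisymm h1 (not_lt.1 hz)
  refine not_hasGleasonWhitney_of_fibers hh.measurable ?_
    ⟨1, ⟨differentiableOn_const 1, 1, by simp⟩, ?_⟩ ?_
  · intro n
    obtain ⟨t, ht, h0, h1⟩ := one_div_succ_Ioo_nonempty n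
    rw [areaMeasure, comap_subtype_coe_apply measurableSet_closedBall]
    have hsub : Metric.ball (0 : ℂ) 1 ∩
        (fun z : ℂ => ‖z‖) ⁻¹' Set.Ioo (1 / ((n + 1 : ℕ) + 1 : ℝ)) (1 / ((n : ℝ) + 1)) ⊆
        (↑) '' ((fun z : Metric.closedBall (0 : ℂ) 1 => ‖(z : ℂ)‖) ⁻¹'
          Set.Ioo (1 / ((n + 1 : ℕ) + 1 : ℝ)) (1 / ((n : ℝ) + 1))) :=
      fun z hz => ⟨⟨z, Metric.ball_subset_closedBall hz.1⟩, hz.2, rfl⟩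
    refine (lt_of_lt_of_le (IsOpen.measure_pos volume
      (Metric.isOpen_ball.inter (isOpen_Ioo.preimage continuous_norm)) ⟨(t : ℂ), ?_, ?_⟩)
      (measure_mono hsub)).ne'
    · simpa [abs_of_pos h0] using h1
    · simpa [abs_of_pos h0] using ht
  · filter_upwards [Lp.coeFn_const (p := ∞) (μ := areaMeasure) (1 : ℂ)] with s hs _
    rw [hs]
    rfl
  rintro F ⟨f, ⟨hf, C, hC⟩, hF⟩
  refine ⟨f 0, fun I hI => ?_⟩
  let g : Metric.closedBall (0 : ℂ) 1 → ℂ := fun z => if ‖(z : ℂ)‖ < 1 then f z else f 0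
  have hball : MeasurableSet {z : Metric.closedBall (0 : ℂ) 1 | ‖(z : ℂ)‖ < 1} :=
    measurableSet_lt hh.measurable measurable_const
  have hg : Measurable g := by
    refine measurable_of_restrict_of_restrict_compl hball ?_ ?_
    · refine Continuous.measurable ?_
      have : Set.domRestrict {z : Metric.closedBall (0 : ℂ) 1 | ‖(z : ℂ)‖ < 1} g =
          fun z => f z.1.1 := by
        funext z
        exact if_pos z.2
      rw [this]
      exact hf.continuousOn.comp_continuous (by fun_prop) fun z =>
        mem_ball_zero_iff.2 z.2
    · have : Set.domRestrict {z : Metric.closedBall (0 : ℂ) 1 | ‖(z : ℂ)‖ < 1}ᶜ g =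
          fun _ => f 0 := by
        funext z
        exact if_neg z.2
      rw [this]
      exact measurable_const
  have hFg : ∫ s in (fun z : Metric.closedBall (0 : ℂ) 1 => ‖(z : ℂ)‖) ⁻¹' I, F s ∂areaMeasure =
      ∫ s in (fun z : Metric.closedBall (0 : ℂ) 1 => ‖(z : ℂ)‖) ⁻¹' I, g s ∂areaMeasure := by
    refine integral_congr_ae (ae_restrict_of_ae ?_)
    filter_upwards [hF, hnull] with z h1 h2
    rw [h1 (by simpa using h2)]
    exact (if_pos h2).symm
  rw [hFg]
  refine setIntegral_eq_of_circle_mean ha.measurable haμ (hh.measurable hI)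
    (fun ζ => by ext s; simp [hha]) hg (C := C) ?_ ?_
  · intro z
    simp only [g]
    split_ifs with h
    · exact hC _ (by simpa using h)
    · exact hC _ (by simp)
  · intro z
    simp only [g, hha]
    by_cases h : ‖(z : ℂ)‖ < 1
    · simp only [h, if_true]
      refine integral_circle_smul hf fun w hw => ?_
      rw [mem_ball_zero_iff, norm_smul]
      exact (mul_le_of_le_one_left (norm_nonneg _) hw).trans_lt h
    · simp [h]

/-! ### Subspaces of continuous functions -/

section Continuous

variable {S : Type*} [TopologicalSpace S] [MeasurableSpace S] {μ : Measure S}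

theorem neBot_nhds_inf_ae [μ.IsOpenPosMeasure] (s : S) : (𝓝 s ⊓ ae μ).NeBot := by
  rw [inf_neBot_iff]
  intro V hV B hB
  by_contra h
  have h1 : V ⊆ Bᶜ := fun t ht htB => h ⟨t, ht, htB⟩
  exact (Measure.measure_pos_of_mem_nhds μ hV).ne' (measure_mono_null h1 hB)

/-- If `F` essentially tends to zero at a dense set of points, the supremum norm of a continuous
function `f` is at most the essential supremum norm of `f + F`. -/
theorem norm_le_norm_add_of_dense [μ.IsOpenPosMeasure] {F G : Lp ℂ ∞ μ}
    (hF : Dense {s | Tendsto F (𝓝 s ⊓ ae μ) (𝓝 0)}) {f : S → ℂ} (hf : Continuous f)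
    (hG : G =ᵐ[μ] f) (s : S) : ‖f s‖ ≤ ‖G + F‖ := by
  refine hF.induction ?_ (isClosed_le hf.norm continuous_const) s
  intro s hs
  have := neBot_nhds_inf_ae (μ := μ) s
  have h1 : Tendsto (fun t => ‖f t + F t‖) (𝓝 s ⊓ ae μ) (𝓝 ‖f s + 0‖) :=
    (((hf.tendsto s).mono_left inf_le_left).add hs).norm
  rw [add_zero] at h1
  refine le_of_tendsto h1 (Eventually.filter_mono inf_le_right ?_)
  filter_upwards [ae_norm_le_norm (G + F), Lp.coeFn_add G F, hG] with t h2 h3 h4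
  rwa [h3, Pi.add_apply, h4] at h2

/-- A subspace of continuous functions, and a weak-* limit `F` of its elements which essentially
vanishes at a dense set of points without having mean zero. -/
theorem not_hasGleasonWhitney_of_dense [IsProbabilityMeasure μ] [μ.IsOpenPosMeasure]
    {X Y : Submodule ℂ (Lp ℂ ∞ μ)} (h : X ≤ Y) (hX : ∀ G ∈ X, ∃ f, Continuous f ∧ G =ᵐ[μ] f)
    (h1 : Lp.const ∞ μ 1 ∈ X) {F : Lp ℂ ∞ μ} (hFY : F ∈ Y) {u : ℕ → Lp ℂ ∞ μ}
    (huX : ∀ n, u n ∈ X) (hu : ∀ n, ∀ᵐ s ∂μ, ‖u n s‖ ≤ 1)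
    (huF : ∀ᵐ s ∂μ, Tendsto (fun n => u n s) atTop (𝓝 (F s))) (hF0 : ∫ s, F s ∂μ ≠ 0)
    (hF : Dense {s | Tendsto F (𝓝 s ⊓ ae μ) (𝓝 0)}) :
    ¬ HasGleasonWhitney (linftyPairing μ) X Y h := by
  have hΦ : ∀ G : Lp ℂ ∞ μ, averageFunctional μ MeasurableSet.univ G = ∫ s, G s ∂μ := fun G => by
    simp [averageFunctional_apply]
  have hone := Lp.coeFn_const (p := ∞) (μ := μ) (1 : ℂ)
  refine not_hasGleasonWhitney_of_norm_le h (Φ := averageFunctional μ MeasurableSet.univ)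
    (densityFunctional_apply _) (norm_averageFunctional_le _) h1 ?_ ?_ huX hFY
    (tendsto_linftyPairing hu huF) (by rwa [hΦ]) ?_
  · refine norm_le_of_ae_norm_le zero_le_one ?_
    filter_upwards [hone] with s hs
    rw [hs]
    simp
  · rw [hΦ, integral_congr_ae hone]
    simp
  · intro G hG
    obtain ⟨f, hf, hGf⟩ := hX G hG
    rw [hΦ, integral_congr_ae hGf]
    simpa using norm_integral_le_of_norm_le_const (μ := μ)
      (Eventually.of_forall (norm_le_norm_add_of_dense hF hf hGf))

end Continuous

/-! ### Continuous functions on the unit interval -/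

instance : (volume : Measure unitInterval).IsOpenPosMeasure := by
  constructor
  rintro _ ⟨V, hV, rfl⟩ ⟨x, hx⟩
  have hsub : V ∩ Set.Ioo (0 : ℝ) 1 ⊆ Subtype.val '' (Subtype.val ⁻¹' V : Set unitInterval) :=
    fun t ht => ⟨⟨t, Set.Ioo_subset_Icc_self ht.2⟩, ht.1, rfl⟩
  have hne : (V ∩ Set.Ioo (0 : ℝ) 1).Nonempty := by
    refine mem_closure_iff.1 ?_ V hV hx
    rw [closure_Ioo zero_ne_one]
    exact x.2
  rw [Measure.Subtype.volume_def, comap_subtype_coe_apply measurableSet_Icc]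
  exact ((IsOpen.measure_pos volume (hV.inter isOpen_Ioo) hne).trans_le (measure_mono hsub)).ne'

/-- There are closed nowhere dense sets of positive measure. -/
theorem exists_isClosed_dense_compl_measure_pos :
    ∃ K : Set unitInterval, IsClosed K ∧ Dense Kᶜ ∧ volume K ≠ 0 := by
  obtain ⟨D, hD, hDd⟩ := TopologicalSpace.exists_countable_dense unitInterval
  obtain ⟨U, hDU, hU, hU1⟩ := D.exists_isOpen_lt_of_lt (μ := volume) 1
    (by rw [hD.measure_zero]; exact one_pos)
  refine ⟨Uᶜ, hU.isClosed_compl, by rw [compl_compl]; exact hDd.mono hDU, fun h => ?_⟩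
  rw [prob_compl_eq_zero_iff hU.measurableSet] at h
  exact hU1.ne h

theorem not_hasGleasonWhitney_continuousSubspace :
    ¬ HasGleasonWhitney (linftyPairing (volume : Measure unitInterval))
        continuousSubspace ⊤ le_top := by
  obtain ⟨K, hK, hKd, hK0⟩ := exists_isClosed_dense_compl_measure_pos
  let f : ℕ → C(unitInterval, ℂ) := fun n =>
    ⟨fun t => ((hK.apprSeq n t : ℝ) : ℂ), by fun_prop⟩
  have hf : ∀ n, ContinuousMap.toLp ∞ volume ℂ (f n) =ᵐ[volume] f n := fun n =>
    ContinuousMap.coeFn_toLp volume (f n)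
  have hF := indicatorConstLp_coeFn (p := ∞) (hs := hK.measurableSet)
    (hμs := measure_ne_top (volume : Measure unitInterval) K) (c := (1 : ℂ))
  refine not_hasGleasonWhitney_of_dense le_top ?_ ?_
    (F := indicatorConstLp ∞ hK.measurableSet (measure_ne_top _ K) 1) trivial
    (u := fun n => ContinuousMap.toLp ∞ volume ℂ (f n)) (fun n => ⟨f n, rfl⟩) ?_ ?_ ?_ ?_
  · rintro _ ⟨g, rfl⟩
    exact ⟨g, g.continuous, ContinuousMap.coeFn_toLp volume g⟩
  · refine ⟨ContinuousMap.const _ 1, Lp.ext ?_⟩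
    filter_upwards [ContinuousMap.coeFn_toLp (p := ∞) (𝕜 := ℂ) (volume : Measure unitInterval)
      (ContinuousMap.const _ (1 : ℂ)),
      Lp.coeFn_const (p := ∞) (μ := (volume : Measure unitInterval)) (1 : ℂ)] with t h1 h2
    rw [h2]
    exact h1
  · intro n
    filter_upwards [hf n] with t ht
    rw [ht]
    have := HasOuterApproxClosed.apprSeq_apply_le_one hK n t
    simpa [f] using this
  · filter_upwards [ae_all_iff.2 hf, hF] with t h1 h2
    simp only [h1, h2]
    have h3 := tendsto_pi_nhds.1 (HasOuterApproxClosed.tendsto_apprSeq hK) t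
    have h4 : Continuous fun x : NNReal => ((x : ℝ) : ℂ) := by fun_prop
    convert! (h4.tendsto _).comp h3 using 2
    by_cases ht : t ∈ K <;> simp [ht]
  · rw [integral_congr_ae hF, integral_indicator hK.measurableSet]
    simpa [Measure.real, ENNReal.toReal_eq_zero_iff] using hK0
  · refine hKd.mono fun s hs => ?_
    refine tendsto_const_nhds.congr' ?_
    have h1 : ∀ᶠ t in 𝓝 s ⊓ ae volume, t ∈ Kᶜ :=
      Eventually.filter_mono inf_le_left (hK.isOpen_compl.mem_nhds hs)
    filter_upwards [h1, Eventually.filter_mono inf_le_right hF] with t h2 h3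
    rw [h3, Set.indicator_of_notMem h2]

/-! ### A bounded holomorphic function vanishing at a dense set of boundary points -/

/-- The function `log (2 / (1 - w))` on the disc. Its real part is nonnegative and tends to infinity
at the boundary point `1`. -/
noncomputable def logKernel (w : ℂ) : ℂ := (Real.log 2 : ℝ) - Complex.log (1 - w)

theorem logKernel_re (w : ℂ) : (logKernel w).re = Real.log 2 - Real.log ‖1 - w‖ := by
  rw [logKernel, Complex.sub_re, Complex.ofReal_re, Complex.log_re]

theorem logKernel_re_nonneg {w : ℂ} (hw : ‖w‖ ≤ 1) : 0 ≤ (logKernel w).re := by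
  rw [logKernel_re, sub_nonneg]
  rcases eq_or_ne (1 - w) 0 with h | h
  · rw [h, norm_zero, Real.log_zero]
    exact Real.log_nonneg one_le_two
  · refine Real.log_le_log (norm_pos_iff.2 h) ((norm_sub_le _ _).trans ?_)
    rw [norm_one]
    linarith

theorem tendsto_logKernel_re : Tendsto (fun w => (logKernel w).re) (𝓝[≠] 1) atTop := by
  simp only [logKernel_re]
  refine tendsto_atTop_add_const_left _ _ (tendsto_neg_atBot_atTop.comp ?_)
  refine (Real.tendsto_log_nhdsNE_zero).comp (tendsto_nhdsWithin_iff.2 ⟨?_, ?_⟩)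
  · have : Continuous fun w : ℂ => ‖1 - w‖ := by fun_prop
    have h := this.tendsto 1
    rw [sub_self, norm_zero] at h
    exact h.mono_left nhdsWithin_le_nhds
  · filter_upwards [self_mem_nhdsWithin] with w hw
    exact norm_ne_zero_iff.2 (sub_ne_zero.2 (Ne.symm hw))

theorem differentiableAt_logKernel {w : ℂ} (hw : ‖w‖ ≤ 1) (hw1 : w ≠ 1) :
    DifferentiableAt ℂ logKernel w := by
  have hmem : 1 - w ∈ Complex.slitPlane := by
    refine Or.inl ?_
    rw [Complex.sub_re, Complex.one_re, sub_pos]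
    refine lt_of_le_of_ne ((Complex.re_le_norm w).trans hw) fun h => hw1 ?_
    have h1 := Complex.sq_norm w
    rw [Complex.normSq_apply, h] at h1
    have h2 : w.im = 0 := by nlinarith [norm_nonneg w, sq_nonneg w.im]
    exact Complex.ext h h2
  unfold logKernel
  exact (differentiableAt_const _).sub
    (((differentiableAt_const _).sub differentiableAt_id).clog hmem)

/-- The sum `∑ c k log (2 / (1 - z / ζ k))`. -/
noncomputable def logSum (c : ℕ → ℝ) (ζ : ℕ → Circle) (z : ℂ) : ℂ :=
  ∑' k, (c k : ℂ) * logKernel (((ζ k)⁻¹ : Circle) * z)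

section LogSum

variable {c : ℕ → ℝ} {ζ : ℕ → Circle}

theorem logSum_re_nonneg (hc : ∀ k, 0 ≤ c k) {z : ℂ} (hz : ‖z‖ ≤ 1) : 0 ≤ (logSum c ζ z).re := by
  by_cases h : Summable fun k => (c k : ℂ) * logKernel (((ζ k)⁻¹ : Circle) * z)
  · rw [logSum, Complex.re_tsum h]
    refine tsum_nonneg fun k => ?_
    rw [Complex.re_ofReal_mul]
    exact mul_nonneg (hc k) (logKernel_re_nonneg (by simpa [Circle.norm_coe] using hz))
  · rw [logSum, tsum_eq_zero_of_not_summable h, Complex.zero_re]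

theorem differentiableOn_logSum (hc : ∀ k, 0 ≤ c k) (hcs : Summable c) :
    DifferentiableOn ℂ (logSum c ζ) (Metric.ball 0 1) := by
  intro z hz
  rw [mem_ball_zero_iff] at hz
  obtain ⟨ρ, hzρ, hρ⟩ := exists_between hz
  have hne : ∀ w : ℂ, ‖w‖ ≤ ρ → w ≠ 1 := by
    rintro w hw rfl
    rw [norm_one] at hw
    exact absurd hw (not_le.2 hρ)
  obtain ⟨B, hB⟩ := (isCompact_closedBall (0 : ℂ) ρ).exists_bound_of_continuousOn
    (f := logKernel) fun w hw => by
      rw [mem_closedBall_zero_iff] at hw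
      exact (differentiableAt_logKernel (hw.trans hρ.le) (hne w hw)).continuousAt.continuousWithinAt
  have hmem : ∀ k, ∀ w ∈ Metric.ball (0 : ℂ) ρ, ‖((ζ k)⁻¹ : Circle) * w‖ ≤ ρ := by
    intro k w hw
    rw [norm_mul, Circle.norm_coe, one_mul]
    exact (mem_ball_zero_iff.1 hw).le
  have hdiff : DifferentiableOn ℂ (logSum c ζ) (Metric.ball 0 ρ) := by
    refine Complex.differentiableOn_tsum_of_summable_norm (hcs.mul_right B) (fun k w hw => ?_)
      Metric.isOpen_ball fun k w hw => ?_
    · have h1 := differentiableAt_logKernel ((hmem k w hw).trans hρ.le) (hne _ (hmem k w hw))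
      exact ((h1.comp w (differentiableAt_id.const_mul _)).const_mul _).differentiableWithinAt
    · rw [norm_mul, Complex.norm_real, Real.norm_of_nonneg (hc k)]
      exact mul_le_mul_of_nonneg_left (hB _ (mem_closedBall_zero_iff.2 (hmem k w hw))) (hc k)
  exact (hdiff.differentiableAt (Metric.isOpen_ball.mem_nhds
    (mem_ball_zero_iff.2 hzρ))).differentiableWithinAt

/-- The terms of `logSum` are dominated along the radius which ends at `ξ`. -/
def RadiallyDominated (c : ℕ → ℝ) (ζ : ℕ → Circle) (ξ : Circle) : Prop :=
  (∀ k, ξ ≠ ζ k) ∧ ∃ b : ℕ → ℝ, Summable b ∧ ∀ k, ∀ r ∈ Set.Icc (0 : ℝ) 1,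
    ‖(c k : ℂ) * logKernel (((ζ k)⁻¹ : Circle) * (r * ξ))‖ ≤ b k

theorem norm_inv_mul_ofReal_mul_le (η ξ : Circle) {r : ℝ} (hr : r ∈ Set.Icc (0 : ℝ) 1) :
    ‖((η⁻¹ : Circle) : ℂ) * (r * ξ)‖ ≤ 1 := by
  rw [norm_mul, norm_mul, Circle.norm_coe, Circle.norm_coe, one_mul, mul_one, Complex.norm_real,
    Real.norm_of_nonneg hr.1]
  exact hr.2

theorem inv_mul_ofReal_mul_ne_one {η ξ : Circle} (h : ξ ≠ η) {r : ℝ} (hr : r ∈ Set.Icc (0 : ℝ) 1) :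
    ((η⁻¹ : Circle) : ℂ) * (r * ξ) ≠ 1 := by
  intro h1
  have h2 := congrArg norm h1
  rw [norm_mul, norm_mul, Circle.norm_coe, Circle.norm_coe, one_mul, mul_one, Complex.norm_real,
    Real.norm_of_nonneg hr.1, norm_one] at h2
  rw [h2, Complex.ofReal_one, one_mul, ← Circle.coe_mul, Circle.coe_eq_one, inv_mul_eq_one] at h1
  exact h h1.symm

theorem continuousAt_logKernel_radius {η ξ : Circle} (h : ξ ≠ η) {r : ℝ}
    (hr : r ∈ Set.Icc (0 : ℝ) 1) :
    ContinuousAt logKernel (((η⁻¹ : Circle) : ℂ) * (r * ξ)) :=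
  (differentiableAt_logKernel (norm_inv_mul_ofReal_mul_le η ξ hr)
    (inv_mul_ofReal_mul_ne_one h hr)).continuousAt

theorem RadiallyDominated.tendsto {ξ : Circle} (h : RadiallyDominated c ζ ξ) :
    Tendsto (fun r : ℝ => logSum c ζ (r * ξ)) (𝓝[<] 1) (𝓝 (logSum c ζ ξ)) := by
  obtain ⟨hξ, b, hb, hbound⟩ := h
  refine tendsto_tsum_of_dominated_convergence hb (fun k => ?_) ?_
  · have h1 := continuousAt_logKernel_radius (hξ k) (Set.right_mem_Icc.2 zero_le_one)
    have h2 : Continuous fun r : ℝ => (((ζ k)⁻¹ : Circle) : ℂ) * (r * ξ) := by fun_prop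
    have h3 := (h1.tendsto.comp (h2.tendsto 1)).const_mul (c k : ℂ)
    rw [Complex.ofReal_one, one_mul] at h3
    exact h3.mono_left nhdsWithin_le_nhds
  · filter_upwards [Ioo_mem_nhdsLT (zero_lt_one' ℝ)] with r hr k
    exact hbound k r (Set.Ioo_subset_Icc_self hr)

theorem RadiallyDominated.le_logSum_re {ξ : Circle} (h : RadiallyDominated c ζ ξ)
    (hc : ∀ k, 0 ≤ c k) (k : ℕ) :
    c k * (logKernel (((ζ k)⁻¹ * ξ : Circle) : ℂ)).re ≤ (logSum c ζ ξ).re := by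
  obtain ⟨-, b, hb, hbound⟩ := h
  have hs : Summable fun k => (c k : ℂ) * logKernel (((ζ k)⁻¹ : Circle) * ξ) := by
    refine Summable.of_norm_bounded hb fun k => ?_
    simpa using hbound k 1 (Set.right_mem_Icc.2 zero_le_one)
  rw [logSum, Complex.re_tsum hs, ← Complex.re_ofReal_mul, Circle.coe_mul]
  refine (Complex.hasSum_re hs.hasSum).summable.le_tsum k fun j _ => ?_
  rw [Complex.re_ofReal_mul]
  exact mul_nonneg (hc j) (logKernel_re_nonneg (by simp [Circle.norm_coe]))

end LogSum

instance : Nontrivial Circle := by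
  refine ⟨Circle.exp Real.pi, 1, fun h => ?_⟩
  have := congrArg (fun z : Circle => (z : ℂ)) h
  norm_num [Circle.coe_exp] at this

/-- A small multiple of `logKernel` with pole `η` is small along the radii which end outside a
small neighbourhood of `η`. -/
theorem exists_weight (η : Circle) {ε : ℝ} (hε : 0 < ε) :
    ∃ c : ℝ, 0 < c ∧ c ≤ ε ∧ ∃ V : Set Circle, circleMeasure V ≤ ENNReal.ofReal ε ∧
      ∀ ξ ∉ V, ∀ r ∈ Set.Icc (0 : ℝ) 1,
        ‖(c : ℂ) * logKernel (((η⁻¹ : Circle) : ℂ) * (r * ξ))‖ ≤ ε := by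
  obtain ⟨V, hηV, hV, hVε⟩ := Set.exists_isOpen_lt_of_lt (μ := circleMeasure) {η}
    (ENNReal.ofReal ε) (by rw [measure_singleton]; exact ENNReal.ofReal_pos.2 hε)
  have hne : ∀ ξ ∉ V, ξ ≠ η := by
    rintro ξ hξ rfl
    exact hξ (hηV rfl)
  obtain ⟨B, hB⟩ := ((isCompact_Icc (a := (0 : ℝ)) (b := 1)).prod
    hV.isClosed_compl.isCompact).exists_bound_of_continuousOn
    (f := fun x : ℝ × Circle => logKernel (((η⁻¹ : Circle) : ℂ) * (x.1 * x.2))) (by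
      rintro ⟨r, ξ⟩ ⟨hr, hξ⟩
      have h1 : Continuous fun x : ℝ × Circle => ((η⁻¹ : Circle) : ℂ) * (x.1 * x.2) := by fun_prop
      exact (ContinuousAt.comp (f := fun x : ℝ × Circle => ((η⁻¹ : Circle) : ℂ) * (x.1 * x.2))
        (continuousAt_logKernel_radius (hne ξ hξ) hr) h1.continuousAt).continuousWithinAt)
  have hB1 : 0 < 1 + |B| := by positivity
  refine ⟨ε / (1 + |B|), by positivity, div_le_self hε.le (by linarith [abs_nonneg B]), V, hVε.le,
    fun ξ hξ r hr => ?_⟩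
  rw [norm_mul, Complex.norm_real, Real.norm_of_nonneg (by positivity), div_mul_eq_mul_div,
    div_le_iff₀ hB1]
  gcongr
  exact (hB (r, ξ) ⟨hr, hξ⟩).trans ((le_abs_self B).trans (by linarith))

/-- By the Borel–Cantelli lemma, the weights can be chosen in such a way that `logSum` has radial
limits almost everywhere. -/
theorem exists_weights (ζ : ℕ → Circle) :
    ∃ c : ℕ → ℝ, (∀ k, 0 < c k) ∧ Summable c ∧ ∀ᵐ ξ ∂circleMeasure, RadiallyDominated c ζ ξ := by
  have hε : ∀ k : ℕ, (0 : ℝ) < (1 / 2) ^ k := fun k => by positivity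
  choose c hc0 hc1 V hV hbound using fun k => exists_weight (ζ k) (hε k)
  refine ⟨c, hc0, Summable.of_nonneg_of_le (fun k => (hc0 k).le) hc1 summable_geometric_two, ?_⟩
  have hsum : ∑' k, circleMeasure (V k) ≠ ∞ :=
    ne_top_of_le_ne_top summable_geometric_two.tsum_ofReal_ne_top (ENNReal.tsum_le_tsum hV)
  have hne : ∀ᵐ ξ ∂circleMeasure, ∀ k, ξ ≠ ζ k :=
    ae_all_iff.2 fun k => compl_mem_ae_iff.2 (measure_singleton _)
  filter_upwards [ae_eventually_notMem hsum, hne] with ξ hξ hξne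
  refine ⟨hξne, ?_⟩
  have hM : ∀ k, ∃ M, ∀ r ∈ Set.Icc (0 : ℝ) 1,
      ‖(c k : ℂ) * logKernel (((ζ k)⁻¹ : Circle) * (r * ξ))‖ ≤ M := by
    intro k
    refine isCompact_Icc.exists_bound_of_continuousOn fun r hr => ?_
    have h1 : Continuous fun r : ℝ => (((ζ k)⁻¹ : Circle) : ℂ) * (r * ξ) := by fun_prop
    exact ((ContinuousAt.comp (f := fun r : ℝ => (((ζ k)⁻¹ : Circle) : ℂ) * (r * ξ))
      (continuousAt_logKernel_radius (hξne k) hr) h1.continuousAt).const_mul _).continuousWithinAt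
  choose M hM using hM
  classical
  refine ⟨fun k => if ξ ∈ V k then M k else (1 / 2) ^ k, ?_, fun k r hr => ?_⟩
  · refine (summable_congr_cofinite ?_).2 summable_geometric_two
    rw [Nat.cofinite_eq_atTop]
    filter_upwards [hξ] with k hk
    exact if_neg hk
  · beta_reduce
    split_ifs with h
    · exact hM k r hr
    · exact hbound k ξ h r hr

theorem not_hasGleasonWhitney_discAlgebra :
    ¬ HasGleasonWhitney (linftyPairing circleMeasure) discAlgebra hinfCircle
        discAlgebra_le_hinfCircle := by
  let ζ : ℕ → Circle := TopologicalSpace.denseSeq Circle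
  obtain ⟨c, hc0, hcs, hdom⟩ := exists_weights ζ
  have hc : ∀ k, 0 ≤ c k := fun k => (hc0 k).le
  let y : ℂ → ℂ := fun z => Complex.exp (-logSum c ζ z)
  have hy1 : ∀ z : ℂ, ‖z‖ ≤ 1 → ‖y z‖ ≤ 1 := by
    intro z hz
    rw [Complex.norm_exp, Real.exp_le_one_iff, Complex.neg_re, neg_nonpos]
    exact logSum_re_nonneg hc hz
  have hyd : DifferentiableOn ℂ y (Metric.ball 0 1) := (differentiableOn_logSum hc hcs).neg.cexp
  have hrad : ∀ᵐ ξ : Circle ∂circleMeasure,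
      Tendsto (fun r : ℝ => y ((r : ℂ) * ξ)) (𝓝[<] 1) (𝓝 (y ξ)) := by
    filter_upwards [hdom] with ξ hξ
    exact (Complex.continuous_exp.tendsto _).comp hξ.tendsto.neg
  -- the dilates of `y`
  have hdil : ∀ n, DiffContOnCl ℂ (fun z => y ((radius n : ℂ) * z)) (Metric.ball 0 1) := by
    intro n
    refine DifferentiableOn.diffContOnCl ?_
    rw [closure_ball (0 : ℂ) one_ne_zero]
    refine hyd.comp (by fun_prop) fun z hz => ?_
    rw [mem_closedBall_zero_iff] at hz
    rw [mem_ball_zero_iff, norm_mul, Complex.norm_real, Real.norm_of_nonneg (radius_mem n).1]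
    exact (mul_le_of_le_one_right (radius_mem n).1 hz).trans_lt (radius_mem n).2
  have hdilc : ∀ n, Continuous fun ξ : Circle => y ((radius n : ℂ) * ξ) := by
    intro n
    have := (hdil n).continuousOn
    rw [closure_ball (0 : ℂ) one_ne_zero] at this
    exact this.comp_continuous continuous_subtype_val fun ξ => by simp [Circle.norm_coe]
  have hdil1 : ∀ n (ξ : Circle), ‖y ((radius n : ℂ) * ξ)‖ ≤ 1 := by
    intro n ξ
    refine hy1 _ ?_
    rw [norm_mul, Circle.norm_coe, mul_one, Complex.norm_real,
      Real.norm_of_nonneg (radius_mem n).1]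
    exact (radius_mem n).2.le
  have hlim : ∀ᵐ ξ : Circle ∂circleMeasure,
      Tendsto (fun n => y ((radius n : ℂ) * ξ)) atTop (𝓝 (y ξ)) := by
    filter_upwards [hrad] with ξ hξ
    exact hξ.comp tendsto_radius
  have hmem : MemLp (fun ξ : Circle => y ξ) ∞ circleMeasure :=
    memLp_top_of_bound (aestronglyMeasurable_of_tendsto_ae atTop
      (fun n => (hdilc n).aestronglyMeasurable) hlim) 1
      (Eventually.of_forall fun ξ => hy1 _ (by simp [Circle.norm_coe]))
  have hmemn : ∀ n, MemLp (fun ξ : Circle => y ((radius n : ℂ) * ξ)) ∞ circleMeasure := fun n =>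
    memLp_top_of_bound (hdilc n).aestronglyMeasurable 1 (Eventually.of_forall (hdil1 n))
  have hF := hmem.coeFn_toLp
  have hu := fun n => (hmemn n).coeFn_toLp
  refine not_hasGleasonWhitney_of_dense discAlgebra_le_hinfCircle ?_ ?_ (F := hmem.toLp) ?_
    (u := fun n => (hmemn n).toLp) (fun n => ⟨_, hdil n, hu n⟩) ?_ ?_ ?_ ?_
  · rintro G ⟨f, hf, hG⟩
    have := hf.continuousOn
    rw [closure_ball (0 : ℂ) one_ne_zero] at this
    exact ⟨_, this.comp_continuous continuous_subtype_val fun ξ => by simp [Circle.norm_coe], hG⟩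
  · exact ⟨fun _ => 1, diffContOnCl_const, Lp.coeFn_const (p := ∞) (μ := circleMeasure) (1 : ℂ)⟩
  · refine ⟨y, ⟨hyd, 1, fun z hz => hy1 z (mem_ball_zero_iff.1 hz).le⟩, ?_⟩
    filter_upwards [hF, hrad] with ξ h1 h2
    rw [h1]
    exact h2
  · intro n
    filter_upwards [hu n] with ξ hξ
    rw [hξ]
    exact hdil1 n ξ
  · filter_upwards [ae_all_iff.2 hu, hF, hlim] with ξ h1 h2 h3
    simp only [h1, h2]
    exact h3
  · -- the mean of the boundary values is `y 0`, because this holds for all dilates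
    have h1 : Tendsto (fun n => ∫ ξ : Circle, y ((radius n : ℂ) * ξ) ∂circleMeasure) atTop
        (𝓝 (∫ ξ : Circle, y ξ ∂circleMeasure)) :=
      tendsto_integral_of_dominated_convergence (fun _ => 1)
        (fun n => (hdilc n).aestronglyMeasurable) (integrable_const 1)
        (fun n => Eventually.of_forall (hdil1 n)) hlim
    have h2 : ∀ n, ∫ ξ : Circle, y ((radius n : ℂ) * ξ) ∂circleMeasure = y 0 := fun n => by
      simpa using integral_circleMeasure (hdil n)
    simp only [h2] at h1
    rw [integral_congr_ae hF, ← tendsto_nhds_unique tendsto_const_nhds h1]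
    exact Complex.exp_ne_zero _
  · refine (TopologicalSpace.denseRange_denseSeq Circle).mono ?_
    rintro _ ⟨k, rfl⟩
    have hle : 𝓝 (ζ k) ⊓ ae circleMeasure ≤ 𝓝[≠] ζ k :=
      inf_le_inf_left _ (le_principal_iff.2 (compl_mem_ae_iff.2 (measure_singleton _)))
    have h1 : Tendsto (fun ξ : Circle => (((ζ k)⁻¹ * ξ : Circle) : ℂ)) (𝓝[≠] ζ k) (𝓝[≠] 1) := by
      refine tendsto_nhdsWithin_iff.2 ⟨?_, ?_⟩
      · have : Continuous fun ξ : Circle => (((ζ k)⁻¹ * ξ : Circle) : ℂ) := by fun_prop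
        have h := this.tendsto (ζ k)
        rw [inv_mul_cancel, Circle.coe_one] at h
        exact h.mono_left nhdsWithin_le_nhds
      · filter_upwards [self_mem_nhdsWithin] with ξ hξ
        rw [Set.mem_compl_singleton_iff, Ne, Circle.coe_eq_one, inv_mul_eq_one]
        exact Ne.symm hξ
    have h2 : Tendsto (fun ξ : Circle =>
        Real.exp (-(c k * (logKernel (((ζ k)⁻¹ * ξ : Circle) : ℂ)).re)))
        (𝓝 (ζ k) ⊓ ae circleMeasure) (𝓝 0) :=
      Real.tendsto_exp_neg_atTop_nhds_zero.comp
        (((tendsto_logKernel_re.comp h1).const_mul_atTop (hc0 k)).mono_left hle)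
    refine squeeze_zero_norm' (Eventually.filter_mono inf_le_right ?_) h2
    filter_upwards [hF, hdom] with ξ h3 h4
    rw [h3, Complex.norm_exp, Complex.neg_re]
    exact Real.exp_le_exp.2 (neg_le_neg (h4.le_logSum_re hc k))

end GleasonWhitney

open GleasonWhitney in
theorem mainTheorem3 :
    -- `C[0,1] ⊆ L^∞[0,1]`
    ¬ HasGleasonWhitney (linftyPairing (volume : Measure unitInterval))
        continuousSubspace ⊤ le_top ∧
    -- `L^∞[0,1] ⊆ B(L²[0,1])`
    ¬ HasGleasonWhitney (bhPairing L2I) multiplicationOperators ⊤ le_top ∧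
    -- `A(𝔻) ⊆ H^∞(𝔻)`, relative to `L^∞(𝕋)`
    ¬ HasGleasonWhitney (linftyPairing circleMeasure) discAlgebra hinfCircle discAlgebra_le_hinfCircle ∧
    -- `H^∞(𝔻) ⊆ B(H²)`
    ¬ HasGleasonWhitney (bhPairing HardySpace) hinfHardy ⊤ le_top ∧
    -- `H^∞(𝔻) ⊆ L^∞` of the closed disc with area measure
    ¬ HasGleasonWhitney (linftyPairing areaMeasure) hinfArea ⊤ le_top ∧
    -- `H^∞(𝔹_d) ⊆ L^∞(𝕊_d)`
    (∀ d : ℕ, 2 ≤ d →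
      ¬ HasGleasonWhitney (linftyPairing (sphereMeasure d)) (hinfBall d) ⊤ le_top) ∧
    -- `H^∞(𝔻^d) ⊆ L^∞(𝕋^d)`
    (∀ d : ℕ, 2 ≤ d →
      ¬ HasGleasonWhitney (linftyPairing (torusMeasure d)) (hinfPolydisc d) ⊤ le_top) := by
  exact ⟨not_hasGleasonWhitney_continuousSubspace, not_hasGleasonWhitney_multiplicationOperators,
    not_hasGleasonWhitney_discAlgebra, not_hasGleasonWhitney_hinfHardy,
    not_hasGleasonWhitney_hinfArea, fun _ hd => not_hasGleasonWhitney_hinfBall hd,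
    fun _ hd => not_hasGleasonWhitney_hinfPolydisc hd⟩
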